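/- Let $0<|q|<1$, fix a logarithm $t$ of $q$ (so $q^x=e^{xt}$), and put $(x)_n=\prod_{i=0}^{n-1}(1-xq^i)$, $(q)_\infty=\prod_{i\ge1}(1-q^i)$, and $\left[{m+n\atop n}\right]=\frac{(q)_{m+n}}{(q)_m(q)_n}$ for integers $m,n\ge0$ and $0$ otherwise. Let $p,p',r,s,b$ be integers with $1\le r\le p-1$ and $1\le b,s\le p'-1$, and put $\lambda=|b-s|$. Let $$B(L,b;q)=\sum_{j\in\mathbb Z}\Bigl(q^{j(jpp'+rp'-sp)}\left[{L\atop \frac12(L+s-b)-jp'}\right]-q^{(jp+r)(jp'+s)}\left[{L\atop \frac12(L-s-b)-jp'}\right]\Bigr)$$ be the Forrester--Baxter bosonic polynomial $B^{(p,p')}_{r,s}(L,b)$. *Bailey pairs.* $(\alpha,\beta)$ is a Bailey pair relative to $a$ if $\beta_L=\sum_{i=0}^L\frac{\alpha_i}{(q)_{L-i}(aq)_{L+i}}$ for all $L\ge0$. For integers $A,R$ let $\alpha_L[A,R]$ be the sum of all contributions below that apply to $L$: $1$ if $L=0$; $q^{j(jp'A\pm Rp'\mp sA)}$ if $L=jp'-(\lambda\mp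 b\pm s)/2$, $j\ge1$ (each choice of sign); $-q^{(jA+R)(jp'+s)}$ if $L=jp'-(\lambda-b-s)/2$, $j\ge0$; $-q^{(jA-R)(jp'-s)}$ if $L=jp'-(\lambda+b+s)/2$, $j\ge1$. For $k\ge0$ put $$\alpha^{(k)}=\alpha[p+kp',\,kb+r],\qquad \alpha^{d,(k)}=\alpha[kp'+p'-p,\,kb+b-r],$$ $$\beta^{(0)}_L=\tfrac{(q)_\lambda}{(q)_{2L+\lambda}}B(2L+\lambda,b;q),\qquad \beta^{d,(0)}_L=q^{L(L+\lambda)}\tfrac{(q)_\lambda}{(q)_{2L+\lambda}}B(2L+\lambda,b;1/q),$$ and for both types $\beta^{(k+1)}_L=\sum_{i=0}^L\frac{q^{i(i+\lambda)}}{(q)_{L-i}}\beta^{(k)}_i$. *Branching functions.* For $N\ge1$ let $C$ be the Cartan matrix of $A_{N-1}$, and let $e_\ell$ be the $\ell$-th unit vector, with $e_\ell=0$ if $\ell\notin\{1,\dots,N-1\}$; for $N=1$ the only $n\in\mathbb Z_{\ge0}^{N-1}$ is the empty vector and $(C^{-1}n)_1=0$. Let $w_\ell(n)=\frac{q^{nC^{-1}(n-e_\ell)}}{(q)_{n_1}\cdots(q)_{n_{N-1}}}$.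 The Lepowsky--Primc string functions are $$c^\ell_m(q)=\frac{q^{\frac{\ell(N-\ell)}{2N(N+2)}}}{(q)_\infty}\sum_{n\in\mathbb Z_{\ge0}^{N-1},\ \frac{m+\ell}{2N}+(C^{-1}n)_1\in\mathbb Z}w_\ell(n).$$ With $m_a(j)=a/2+P'j$, the normalized branching function of the coset model $(P,P')_N$ is (the formula being used for all integers $r,s$) $$\hat\chi^{(P,P';N)}_{r,s;\ell}(q)=q^{-\frac{\ell(N-\ell)}{2N(N+2)}}\sum_{0\le m\le N/2,\ m\in\mathbb Z+\ell/2}c^\ell_{2m}(q)\Bigl(\sum_{m_{r-s}(j)\equiv\pm m\,(N)}q^{\frac jN(jPP'+P'r-Ps)}-\sum_{m_{r+s}(j)\equiv\pm m\,(N)}q^{\frac1N(jP'+s)(jP+r)}\Bigr),$$ with sums over $j\in\mathbb Z$. *Left-hand side of the higher-level Bailey lemma.* $$\mathcal L^{N,\lambda}_{\ell,\sigma}(\alpha)=\frac1{(q)_\infty}\sum_{L\ge0}q^{L(L+\lambda)/N}\alpha_L\sum_\eta w_\ell(\eta),$$ where $\eta$ runs over those $\eta\in\mathbb Z_{\ge0}^{N-1}$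 for which $\frac{L+(\lambda-\ell)/2}N-(C^{-1}\eta)_1$ lies in $\mathbb Z+\frac\sigma2$. **Theorem (Bailey flows).** (0) (Source $M(p,p')=(p,p')_1$.) If $\ell\in\{0,1\}$ and $r-s+\ell$ is even, then $\lim_{L\to\infty}B(2L+\lambda,b;q)=\hat\chi^{(p,p';1)}_{r,s;\ell}(q)$. (1) (Flow $M(p,p')\to(p',p'+N(kp'+p))_N$.) For every $k\ge0$, $(\alpha^{(k)},\beta^{(k)})$ is a Bailey pair relative to $q^\lambda$. For all $N\ge1$, $0\le\ell<N$ and $\sigma\in\{0,1\}$ with $\sigma\equiv kb+r\pmod 2$ and $\ell+\lambda+N(kb+r)$ even, $$\mathcal L^{N,\lambda}_{\ell,\sigma}(\alpha^{(k)})=\hat\chi^{(p',\,p'+N(p+kp');N)}_{s,\,b+N(kb+r);\ell}(q).$$ (2) (Dual flow $M(p,p')\stackrel{d}{\to}(p',p'+N(kp'+p'-p))_N$.) If $p<p'$, then for every $k\ge0$, $(\alpha^{d,(k)},\beta^{d,(k)})$ is a Bailey pair relative to $q^\lambda$. For all $N\ge1$, $0\le\ell<N$ and $\sigma\in\{0,1\}$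 with $\sigma\equiv kb+b-r\pmod 2$ and $\ell+\lambda+N(kb+b-r)$ even, $$\mathcal L^{N,\lambda}_{\ell,\sigma}(\alpha^{d,(k)})=\hat\chi^{(p',\,p'+N(kp'+p'-p);N)}_{s,\,b+N(kb+b-r);\ell}(q).$$ All series involved converge absolutely. -/

import Mathlib

/-! `q`-series notation. Throughout, `q = exp t` with `Re t < 0`, so `0 < |q| < 1`, and
fractional powers of `q` are taken with respect to the logarithm `t` of `q`. -/

/-- The power `q ^ x = exp (x t)` of `q = exp t`, for a rational exponent `x`. -/
noncomputable def qpow (t : ℂ) (x : ℚ) : ℂ := Complex.exp ((x : ℂ) * t)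

/-- The finite `q`-shifted factorial `(x; q)_n = (1 - x) (1 - x q) ⋯ (1 - x q ^ (n - 1))`. -/
noncomputable def qShifted (x q : ℂ) (n : ℕ) : ℂ := ∏ i ∈ Finset.range n, (1 - x * q ^ i)

/-- `(q)_n = (q; q)_n`. -/
noncomputable def qFact (q : ℂ) (n : ℕ) : ℂ := qShifted q q n

/-- `(q)_∞ = ∏_{i ≥ 0} (1 - q ^ (i + 1))`. -/
noncomputable def qFactInf (q : ℂ) : ℂ := ∏' i : ℕ, (1 - q ^ (i + 1))

/-- The `q`-binomial coefficient `[m + n; n]`, which equals `(q)_{m+n} / ((q)_m (q)_n)` if `m` and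
`n` are non-negative integers and `0` otherwise. -/
noncomputable def qBinom (q : ℂ) (m n : ℚ) : ℂ :=
  if (⌊m⌋₊ : ℚ) = m ∧ (⌊n⌋₊ : ℚ) = n then
    qFact q (⌊m⌋₊ + ⌊n⌋₊) / (qFact q ⌊m⌋₊ * qFact q ⌊n⌋₊)
  else 0

/-- `(α, β)` is a Bailey pair relative to `a`:
`β_L = ∑_{i=0}^{L} α_i / ((q)_{L-i} (aq)_{L+i})` for all `L ≥ 0`. -/
def IsBaileyPair (q a : ℂ) (α β : ℕ → ℂ) : Prop :=
  ∀ L : ℕ, β L =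
    ∑ i ∈ Finset.range (L + 1), α i / (qFact q (L - i) * qShifted (a * q) q (L + i))

/-! Forrester-Baxter polynomials and the Bailey pairs built from them -/

/-- The bosonic polynomial `B^{(p,p')}_{r,s}(L, b; q)`; the top entry of its `q`-binomials is `L`,
so that `[L; x]` is `qBinom q (L - x) x`. All but finitely many terms vanish. -/
noncomputable def bosonicB (q : ℂ) (p p' r s : ℤ) (L : ℕ) (b : ℤ) : ℂ :=
  ∑' j : ℤ,
    (q ^ (j * (j * p * p' + r * p' - s * p)) *
        qBinom q ((L : ℚ) - (((L : ℚ) + s - b) / 2 - j * p')) (((L : ℚ) + s - b) / 2 - j * p') -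
      q ^ ((j * p + r) * (j * p' + s)) *
        qBinom q ((L : ℚ) - (((L : ℚ) - s - b) / 2 - j * p')) (((L : ℚ) - s - b) / 2 - j * p'))

/-- The sequence `α_L` with parameters `p', b, s` and `(P, R)`. With `lam = |b - s|` it is the sum
of the contributions
* `1` if `L = 0`,
* `q ^ (j (j p' P ± R p' ∓ s P))` if `L = j p' - (lam ∓ b ± s) / 2` with `j ≥ 1`,
* `- q ^ ((j P + R) (j p' + s))` if `L = j p' - (lam - b - s) / 2` with `j ≥ 0`,
* `- q ^ ((j P - R) (j p' - s))` if `L = j p' - (lam + b + s) / 2` with `j ≥ 1`.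
Each sum over `j` below has at most one non-zero term. -/
noncomputable def alphaSeq (q : ℂ) (p' b s P R : ℤ) (L : ℕ) : ℂ :=
  (if L = 0 then 1 else 0) +
  (∑' j : ℤ, if 1 ≤ j ∧ 2 * (L : ℤ) = 2 * j * p' - (|b - s| - b + s) then
      q ^ (j * (j * p' * P + R * p' - s * P)) else 0) +
  (∑' j : ℤ, if 1 ≤ j ∧ 2 * (L : ℤ) = 2 * j * p' - (|b - s| + b - s) then
      q ^ (j * (j * p' * P - R * p' + s * P)) else 0) -
  (∑' j : ℤ, if 0 ≤ j ∧ 2 * (L : ℤ) = 2 * j * p' - (|b - s| - b - s) then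
      q ^ ((j * P + R) * (j * p' + s)) else 0) -
  (∑' j : ℤ, if 1 ≤ j ∧ 2 * (L : ℤ) = 2 * j * p' - (|b - s| + b + s) then
      q ^ ((j * P - R) * (j * p' - s)) else 0)

/-- `α^{(k)}_L` of the `k`-fold iterated Bailey pair; `k = 0` is the original pair. -/
noncomputable def alphaBP (q : ℂ) (p p' r s b : ℤ) (k : ℕ) : ℕ → ℂ :=
  alphaSeq q p' b s (p + k * p') (k * b + r)

/-- `α^{(k)}_L` of the `k`-fold iterated dual Bailey pair; `k = 0` is the dual pair. -/
noncomputable def alphaDualBP (q : ℂ) (p p' r s b : ℤ) (k : ℕ) : ℕ → ℂ :=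
  alphaSeq q p' b s (k * p' + p' - p) (k * b + b - r)

/-- One sum of the Bailey chain relative to `q ^ lam` (with both free parameters sent to infinity):
`β'_L = ∑_{i=0}^{L} q ^ (i (i + lam)) / (q)_{L-i} β_i`. -/
noncomputable def chainStep (q : ℂ) (lam : ℕ) (β : ℕ → ℂ) (L : ℕ) : ℂ :=
  ∑ i ∈ Finset.range (L + 1), q ^ (i * (i + lam)) / qFact q (L - i) * β i

/-- `β^{(k)}_L`, i.e. the sum over `L ≥ r_1 ≥ ⋯ ≥ r_k ≥ 0` of
`q ^ (r_1 (r_1 + lam) + ⋯ + r_k (r_k + lam)) / ((q)_{L - r_1} (q)_{r_1 - r_2} ⋯ (q)_{r_{k-1} - r_k})`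
times `(q)_lam / (q)_{2 r_k + lam} B(2 r_k + lam, b; q)`, where `lam = |b - s|`. -/
noncomputable def betaBP (q : ℂ) (p p' r s b : ℤ) : ℕ → ℕ → ℂ
  | 0 => fun L => qFact q (b - s).natAbs / qFact q (2 * L + (b - s).natAbs) *
      bosonicB q p p' r s (2 * L + (b - s).natAbs) b
  | k + 1 => chainStep q (b - s).natAbs (betaBP q p p' r s b k)

/-- `β^{(k)}_L` of the iterated dual pair, where for `k = 0`
`β_L = q ^ (L (L + lam)) (q)_lam / (q)_{2 L + lam} B(2 L + lam, b; 1 / q)`, `lam = |b - s|`. -/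
noncomputable def betaDualBP (q : ℂ) (p p' r s b : ℤ) : ℕ → ℕ → ℂ
  | 0 => fun L => q ^ (L * (L + (b - s).natAbs)) *
      (qFact q (b - s).natAbs / qFact q (2 * L + (b - s).natAbs)) *
      bosonicB q⁻¹ p p' r s (2 * L + (b - s).natAbs) b
  | k + 1 => chainStep q (b - s).natAbs (betaDualBP q p p' r s b k)

/-! Sums over `n ∈ ℤ_{≥ 0}^{N-1}` attached to the Cartan matrix `C` of type `A_{N-1}` -/

/-- The inverse `C⁻¹` of the Cartan matrix of `A_{N-1}`. The index `i : Fin (N - 1)` stands for the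
node `i + 1`. -/
noncomputable def cartanInv (N : ℕ) : Matrix (Fin (N - 1)) (Fin (N - 1)) ℚ :=
  ((CartanMatrix.A (N - 1)).map (Int.cast : ℤ → ℚ))⁻¹

/-- The explicit form `C⁻¹_{i,j} = min (i, j) - i j / N` (the node of `i : Fin (N - 1)` is `i + 1`);
in particular the matrix inverse in `cartanInv` is a genuine inverse. -/
theorem cartanInv_apply (N : ℕ) (i j : Fin (N - 1)) :
    cartanInv N i j =
      (min (i.val + 1) (j.val + 1) : ℕ) - ((i.val : ℚ) + 1) * ((j.val : ℚ) + 1) / N := by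
  have hN : (N : ℚ) ≠ 0 := by
    have := i.isLt
    exact_mod_cast (by omega : N ≠ 0)
  let D : Matrix (Fin (N - 1)) (Fin (N - 1)) ℚ := Matrix.of fun i j =>
    (min (i.val + 1) (j.val + 1) : ℕ) - ((i.val : ℚ) + 1) * ((j.val : ℚ) + 1) / N
  have key : (CartanMatrix.A (N - 1)).map (Int.cast : ℤ → ℚ) * D = 1 := by
    ext a c
    let f : ℕ → ℚ := fun x => (min x (c.val + 1) : ℕ) - (x : ℚ) * ((c.val : ℚ) + 1) / N
    have hterm : ∀ x : Fin (N - 1),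
        ((CartanMatrix.A (N - 1)).map (Int.cast : ℤ → ℚ)) a x * D x c =
          (if x.val = a.val then 2 * f (x.val + 1) else 0) -
          (if x.val = a.val + 1 then f (x.val + 1) else 0) -
          (if x.val + 1 = a.val then f (x.val + 1) else 0) := by
      intro x
      have hD : D x c = f (x.val + 1) := by
        simp only [D, f, Matrix.of_apply, Nat.cast_add, Nat.cast_one]
      rw [hD]
      simp only [Matrix.map_apply, CartanMatrix.A, Matrix.of_apply, Fin.ext_iff]
      split_ifs <;> first | omega | (push_cast; ring)
    rw [Matrix.mul_apply, Finset.sum_congr rfl (fun x _ => hterm x), Finset.sum_sub_distrib,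
      Finset.sum_sub_distrib,
      Fin.sum_univ_eq_sum_range (fun x => if x = a.val then 2 * f (x + 1) else 0) (N - 1),
      Fin.sum_univ_eq_sum_range (fun x => if x = a.val + 1 then f (x + 1) else 0) (N - 1),
      Fin.sum_univ_eq_sum_range (fun x => if x + 1 = a.val then f (x + 1) else 0) (N - 1)]
    have ha := a.isLt
    have hc := c.isLt
    have h1 : ∑ x ∈ Finset.range (N - 1), (if x = a.val then 2 * f (x + 1) else 0) =
        2 * f (a.val + 1) := by
      rw [Finset.sum_ite_eq' (Finset.range (N - 1)) a.val (fun x => 2 * f (x + 1))]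
      simp
    have h2 : ∑ x ∈ Finset.range (N - 1), (if x = a.val + 1 then f (x + 1) else 0) =
        f (a.val + 2) := by
      rw [Finset.sum_ite_eq' (Finset.range (N - 1)) (a.val + 1) (fun x => f (x + 1))]
      split_ifs with h
      · rfl
      · have hlast : a.val + 2 = N := by
          simp only [Finset.mem_range] at h
          omega
        have hmin : min N (c.val + 1) = c.val + 1 := by omega
        simp only [hlast, f, hmin]
        field_simp
        push_cast
        ring
    have h3 : ∑ x ∈ Finset.range (N - 1), (if x + 1 = a.val then f (x + 1) else 0) =
        f a.val := by
      by_cases h0 : a.val = 0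
      · rw [h0]
        have h0' : min 0 (c.val + 1) = 0 := by omega
        simp only [f, h0']
        simp
      · rw [Finset.sum_eq_single_of_mem (a.val - 1) (Finset.mem_range.2 (by omega))
          (fun x _ hx => if_neg (by omega)), if_pos (by omega)]
        congr 1
        omega
    rw [h1, h2, h3, Matrix.one_apply]
    simp only [f, Fin.ext_iff]
    split_ifs with h
    · rw [h]
      rw [show min (c.val + 1) (c.val + 1) = c.val + 1 by omega,
        show min (c.val + 2) (c.val + 1) = c.val + 1 by omega,
        show min c.val (c.val + 1) = c.val by omega]
      push_cast
      field_simp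
      ring
    · rcases Nat.lt_or_gt_of_ne h with h | h
      · rw [show min (a.val + 1) (c.val + 1) = a.val + 1 by omega,
          show min (a.val + 2) (c.val + 1) = a.val + 2 by omega,
          show min a.val (c.val + 1) = a.val by omega]
        push_cast
        field_simp
        ring
      · rw [show min (a.val + 1) (c.val + 1) = c.val + 1 by omega,
          show min (a.val + 2) (c.val + 1) = c.val + 1 by omega,
          show min a.val (c.val + 1) = c.val + 1 by omega]
        push_cast
        field_simp
        ring
  have hinv : cartanInv N = D := Matrix.inv_eq_right_inv key
  rw [hinv]
  simp [D]

/-- The unit vector `e_ℓ`, which is `0` unless `1 ≤ ℓ ≤ N - 1`. -/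
def unitVec (N ℓ : ℕ) : Fin (N - 1) → ℚ := fun i => if i.val + 1 = ℓ then 1 else 0

/-- The first component `(C⁻¹ n)_1`, read as `0` for `N = 1`, where there are no components. -/
noncomputable def cartanInvFirst (N : ℕ) (n : Fin (N - 1) → ℕ) : ℚ :=
  if h : 0 < N - 1 then (cartanInv N).mulVec (fun i => (n i : ℚ)) ⟨0, h⟩ else 0

/-- The exponent `n C⁻¹ (n - e_ℓ)`. -/
noncomputable def cartanExponent (N ℓ : ℕ) (n : Fin (N - 1) → ℕ) : ℚ :=
  dotProduct (fun i => (n i : ℚ))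
    ((cartanInv N).mulVec ((fun i => (n i : ℚ)) - unitVec N ℓ))

/-- The summand `q ^ (n C⁻¹ (n - e_ℓ)) / ((q)_{n_1} ⋯ (q)_{n_{N-1}})`. -/
noncomputable def parafermionTerm (t : ℂ) (N ℓ : ℕ) (n : Fin (N - 1) → ℕ) : ℂ :=
  qpow t (cartanExponent N ℓ n) / ∏ i, qFact (Complex.exp t) (n i)

/-- The range of summation of the string function: all `n` with
`(m + ℓ) / (2 N) + (C⁻¹ n)_1 ∈ ℤ`. -/
def stringRange (N ℓ : ℕ) (m : ℤ) : Set (Fin (N - 1) → ℕ) :=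
  {n | ∃ z : ℤ, ((m : ℚ) + ℓ) / (2 * N) + cartanInvFirst N n = z}

/-- The level-`N` string function `c_m^ℓ` of `A_1^{(1)}` in the form of Lepowsky and Primc. -/
noncomputable def stringFunction (t : ℂ) (N ℓ : ℕ) (m : ℤ) : ℂ :=
  qpow t ((ℓ : ℚ) * (N - ℓ) / (2 * N * (N + 2))) / qFactInf (Complex.exp t) *
    ∑' n : stringRange N ℓ m, parafermionTerm t N ℓ n

/-! Branching functions of the coset models -/

/-- All `j ∈ ℤ` with `a / 2 + P' j ≡ ± M / 2` modulo `N`. -/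
def thetaRange (P' : ℤ) (N : ℕ) (a M : ℤ) : Set ℤ :=
  {j | (2 * N : ℤ) ∣ a + 2 * P' * j - M ∨ (2 * N : ℤ) ∣ a + 2 * P' * j + M}

/-- The summand `q ^ ((j / N) (j P P' + P' r - P s))`. -/
noncomputable def thetaTermFirst (t : ℂ) (P P' : ℤ) (N : ℕ) (r s : ℤ) (j : ℤ) : ℂ :=
  qpow t ((j : ℚ) / N * (j * P * P' + P' * r - P * s))

/-- The summand `q ^ ((1 / N) (j P' + s) (j P + r))`. -/
noncomputable def thetaTermSecond (t : ℂ) (P P' : ℤ) (N : ℕ) (r s : ℤ) (j : ℤ) : ℂ :=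
  qpow t (1 / (N : ℚ) * ((j * P' + s) * (j * P + r)))

/-- The normalized branching function `χ̂^{(P,P';N)}_{r,s;ℓ}(q)` of the coset model `(P,P')_N`.
The outer sum is over `M = 2 m`, where `0 ≤ m ≤ N / 2` and `m ∈ ℤ + ℓ / 2`. -/
noncomputable def branching (t : ℂ) (P P' : ℤ) (N : ℕ) (r s : ℤ) (ℓ : ℕ) : ℂ :=
  qpow t (-((ℓ : ℚ) * (N - ℓ) / (2 * N * (N + 2)))) *
    ∑ M ∈ Finset.range (N + 1) with M % 2 = ℓ % 2,
      stringFunction t N ℓ M *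
        ((∑' j : thetaRange P' N (r - s) M, thetaTermFirst t P P' N r s j) -
          ∑' j : thetaRange P' N (r + s) M, thetaTermSecond t P P' N r s j)

/-- All series in the definition of `branching` converge absolutely. -/
def BranchingConverges (t : ℂ) (P P' : ℤ) (N : ℕ) (r s : ℤ) (ℓ : ℕ) : Prop :=
  (∀ m : ℤ, Summable fun n : stringRange N ℓ m => parafermionTerm t N ℓ n) ∧
  (∀ M : ℤ, Summable fun j : thetaRange P' N (r - s) M => thetaTermFirst t P P' N r s j) ∧
  (∀ M : ℤ, Summable fun j : thetaRange P' N (r + s) M => thetaTermSecond t P P' N r s j)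

/-! The left-hand side of the higher-level Bailey lemma -/

/-- The range of the inner sum: all `η` such that `(L + (lam - ℓ) / 2) / N - (C⁻¹ η)_1` is an integer
if `σ = 0`, and half an odd integer if `σ = 1`. -/
def etaRange (N lam ℓ σ L : ℕ) : Set (Fin (N - 1) → ℕ) :=
  {η | ∃ z : ℤ, ((L : ℚ) + ((lam : ℚ) - ℓ) / 2) / N - cartanInvFirst N η = z + (σ : ℚ) / 2}

/-- The left-hand side of the higher-level Bailey lemma for the sequence `α` relative to `q ^ lam`. -/
noncomputable def higherLevelLHS (t : ℂ) (N lam ℓ σ : ℕ) (α : ℕ → ℂ) : ℂ :=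
  1 / qFactInf (Complex.exp t) *
    ∑' L : ℕ, qpow t ((L : ℚ) * (L + lam) / N) * α L *
      ∑' η : etaRange N lam ℓ σ L, parafermionTerm t N ℓ η

/-- The double series in `higherLevelLHS` converges absolutely. -/
def HigherLevelLHSConverges (t : ℂ) (N lam ℓ σ : ℕ) (α : ℕ → ℂ) : Prop :=
  Summable fun x : (L : ℕ) × etaRange N lam ℓ σ L =>
    qpow t ((x.1 : ℚ) * (x.1 + lam) / N) * α x.1 * parafermionTerm t N ℓ x.2

/-!
The statement has three elementary ingredients.

**Bailey pairs.** The `q`-binomials in `B(2 L + lam, b; q)` are `[2 L + lam; L - i]`, where the index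
`i` of the `j`-th term is determined by `2 i + lam = |2 j p' + b ∓ s|` (the upper sign for the positive
terms, the lower sign for the negative ones). Collecting the terms with a given `i` produces exactly
`α_i` (`alphaSeq_eq`, `bosonicB_eq_sum`), which is the Bailey pair for `k = 0`. Since `4 i (i + lam)`
is the difference of the squares of `2 j p' + b ∓ s` and `b - s`, multiplication by
`q ^ (i (i + lam))` moves the parameters of `α` by `(P, R) ↦ (P + p', R + b)`; together with the
`q`-Chu–Vandermonde sum `sum_pow_div_qFact` this gives the iterated pairs, and together with
`q ↦ 1/q` the dual ones (`alphaSeq_add`, `alphaSeq_dual`, `IsBaileyPair.chainStep`). Letting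
`L → ∞` termwise gives the source characters (`tendsto_bosonicB`).

**Flows.** Both sides of the flow identity are sums over `j ∈ ℤ` of the same theta-like terms
(`posTerm_eq`, `negTerm_eq`), each multiplied by a sum of parafermion terms over one charge sector:
the sector of the left-hand side is fixed by `|2 j p' + b ∓ s|`, up to a multiple of `N`, and the one
of the branching function by the same number without the absolute value, up to sign and modulo `2 N`.
So `higherLevel_flow` comes down to the fact that the sum over the sector `m` only depends on `± m` modulo `2 N`.

**Weyl symmetry of the string functions** (`parafermionSum_neg`). Writing `n_i = M_i - M_{i+1}`, the
sector becomes the set of weakly decreasing `M ∈ ℤ ^ N` with a prescribed sum `Y`, and the exponent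
`n C⁻¹ (n - e_ℓ)` becomes `∑ M_i ^ 2` plus the sum of the last `N - ℓ` of the `M_i`, minus a function
of `Y` (`cartanExponent_eq`). By a telescoping identity (`sum_ascentWeight`) the product of the last
variables `q ^ M_i` is a sum over `0`-`1` vectors `ε` of monomials `q ^ (ε · M)` with factors
`1 - q ^ (M_i - M_{i+1})` at the ascents of `ε`. These factors shift the denominators
`(q)_{M_i - M_{i+1}}`, and each of the resulting lattice sums is invariant under the reflection
`M ↦ -rev (M + ε)`, `ε ↦ rev ε` (`latticeTerm_reflection`). The reflection maps the sum `Y` to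
`-Y - |ε|` with `|ε| = N - ℓ`, which is `m ↦ -m` on charges modulo `2 N`.
-/

/-! ### The `q`-shifted factorial `(q)_n` and its limit -/

theorem qFact_zero (q : ℂ) : qFact q 0 = 1 := by
  simp [qFact, qShifted]

theorem qFact_succ (q : ℂ) (n : ℕ) : qFact q (n + 1) = qFact q n * (1 - q ^ (n + 1)) := by
  simp [qFact, qShifted, Finset.prod_range_succ, pow_succ']

theorem one_sub_pow_succ_ne_zero {q : ℂ} (hq : ‖q‖ < 1) (n : ℕ) : 1 - q ^ (n + 1) ≠ 0 := by
  intro h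
  have h1 : ‖q ^ (n + 1)‖ < 1 := by
    rw [norm_pow]
    exact pow_lt_one₀ (norm_nonneg _) hq (Nat.succ_ne_zero n)
  rw [← sub_eq_zero.1 h] at h1
  simp at h1

theorem qFact_ne_zero {q : ℂ} (hq : ‖q‖ < 1) (n : ℕ) : qFact q n ≠ 0 := by
  induction n with
  | zero => simp [qFact_zero]
  | succ n ih =>
    rw [qFact_succ]
    exact mul_ne_zero ih (one_sub_pow_succ_ne_zero hq n)

/-- `(q ^ {m + 1}; q)_n = (q)_{m + n} / (q)_m`. -/
theorem qFact_mul_qShifted (q : ℂ) (m n : ℕ) :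
    qFact q m * qShifted (q ^ m * q) q n = qFact q (m + n) := by
  induction n with
  | zero => simp [qShifted]
  | succ n ih =>
    rw [← add_assoc, qFact_succ, ← ih]
    simp only [qShifted, Finset.prod_range_succ]
    ring

theorem summable_norm_pow_succ {q : ℂ} (hq : ‖q‖ < 1) :
    Summable fun i : ℕ => ‖-q ^ (i + 1)‖ := by
  simp only [norm_neg, norm_pow]
  exact (summable_nat_add_iff 1).2 (summable_geometric_of_lt_one (norm_nonneg _) hq)

theorem qFactInf_ne_zero {q : ℂ} (hq : ‖q‖ < 1) : qFactInf q ≠ 0 := by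
  have h := tprod_one_add_ne_zero_of_summable (f := fun i : ℕ => -q ^ (i + 1))
    (fun i => by
      rw [← sub_eq_add_neg]
      exact one_sub_pow_succ_ne_zero hq i) (summable_norm_pow_succ hq)
  simpa only [← sub_eq_add_neg, qFactInf] using h

theorem tendsto_qFact {q : ℂ} (hq : ‖q‖ < 1) :
    Filter.Tendsto (qFact q) Filter.atTop (nhds (qFactInf q)) := by
  have h : Multipliable fun i : ℕ => 1 + -q ^ (i + 1) :=
    multipliable_one_add_of_summable (summable_norm_pow_succ hq)
  simp only [← sub_eq_add_neg] at h
  convert h.hasProd.tendsto_prod_nat using 2 with n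
  · simp [qFact, qShifted, pow_succ']
  · rfl

theorem exists_norm_qFact_le {q : ℂ} (hq : ‖q‖ < 1) :
    ∃ c : ℝ, 1 ≤ c ∧ ∀ n, ‖qFact q n‖ ≤ c := by
  obtain ⟨c, hc⟩ := (Metric.isBounded_range_of_tendsto _ (tendsto_qFact hq)).exists_norm_le
  exact ⟨max 1 c, le_max_left _ _, fun n => (hc _ ⟨n, rfl⟩).trans (le_max_right _ _)⟩

theorem exists_norm_inv_qFact_le {q : ℂ} (hq : ‖q‖ < 1) :
    ∃ c : ℝ, 1 ≤ c ∧ ∀ n, ‖(qFact q n)⁻¹‖ ≤ c := by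
  obtain ⟨c, hc⟩ := (Metric.isBounded_range_of_tendsto _
    ((tendsto_qFact hq).inv₀ (qFactInf_ne_zero hq))).exists_norm_le
  exact ⟨max 1 c, le_max_left _ _, fun n => (hc _ ⟨n, rfl⟩).trans (le_max_right _ _)⟩

theorem qShifted_eq_div {q : ℂ} (hq : ‖q‖ < 1) (lam n : ℕ) :
    qShifted (q ^ lam * q) q n = qFact q (lam + n) / qFact q lam := by
  rw [← qFact_mul_qShifted, mul_div_cancel_left₀ _ (qFact_ne_zero hq lam)]

/-- `(1/q; 1/q)_n = (-1) ^ n q ^ {- n (n + 1) / 2} (q)_n`, where the triangular exponent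
is written as a sum. -/
theorem qFact_inv {q : ℂ} (hq0 : q ≠ 0) (n : ℕ) :
    qFact q⁻¹ n * q ^ (∑ i ∈ Finset.range n, (i + 1)) = (-1) ^ n * qFact q n := by
  induction n with
  | zero => simp [qFact_zero]
  | succ n ih =>
    have h : (1 - q⁻¹ ^ (n + 1)) * q ^ (n + 1) = -(1 - q ^ (n + 1)) := by
      rw [sub_mul, ← mul_pow, inv_mul_cancel₀ hq0]
      ring
    rw [Finset.sum_range_succ, pow_add, qFact_succ, qFact_succ]
    linear_combination (1 - q⁻¹ ^ (n + 1)) * q ^ (n + 1) * ih + (-1) ^ n * qFact q n * h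

theorem qFact_inv_ne_zero {q : ℂ} (hq : ‖q‖ < 1) (hq0 : q ≠ 0) (n : ℕ) : qFact q⁻¹ n ≠ 0 := by
  intro h
  have := qFact_inv hq0 n
  rw [h, zero_mul] at this
  exact mul_ne_zero (pow_ne_zero _ (by norm_num)) (qFact_ne_zero hq n) this.symm

/-- The Gaussian binomial at `1/q` is `q ^ {-m n}` times the one at `q`. -/
theorem qFact_inv_div {q : ℂ} (hq : ‖q‖ < 1) (hq0 : q ≠ 0) (m n : ℕ) :
    q ^ (m * n) * (qFact q⁻¹ (m + n) / (qFact q⁻¹ m * qFact q⁻¹ n)) =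
      qFact q (m + n) / (qFact q m * qFact q n) := by
  have key : (∑ i ∈ Finset.range (m + n), (i + 1)) =
      (∑ i ∈ Finset.range m, (i + 1)) + (∑ i ∈ Finset.range n, (i + 1)) + m * n := by
    rw [Finset.sum_range_add]
    simp only [add_assoc, Finset.sum_add_distrib, Finset.sum_const, Finset.card_range, smul_eq_mul]
    ring
  have h1 := qFact_inv hq0 (m + n)
  have h2 := qFact_inv hq0 m
  have h3 := qFact_inv hq0 n
  have g1 := qFact_ne_zero hq m
  have g2 := qFact_ne_zero hq n
  have g3 := qFact_inv_ne_zero hq hq0 m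
  have g4 := qFact_inv_ne_zero hq hq0 n
  rw [key, pow_add, pow_add, pow_add] at h1
  have p1 : q ^ (∑ i ∈ Finset.range m, (i + 1)) ≠ 0 := pow_ne_zero _ hq0
  have p2 : q ^ (∑ i ∈ Finset.range n, (i + 1)) ≠ 0 := pow_ne_zero _ hq0
  have s1 : ((-1 : ℂ) ^ m) ≠ 0 := pow_ne_zero _ (by norm_num)
  have s2 : ((-1 : ℂ) ^ n) ≠ 0 := pow_ne_zero _ (by norm_num)
  rw [← mul_div_assoc, div_eq_div_iff (mul_ne_zero g3 g4) (mul_ne_zero g1 g2)]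
  apply mul_left_cancel₀ (mul_ne_zero (mul_ne_zero p1 p2) (mul_ne_zero s1 s2))
  linear_combination ((-1) ^ m * qFact q m) * ((-1) ^ n * qFact q n) * h1
    - (-1) ^ m * (-1) ^ n * qFact q (m + n) * ((-1) ^ n * qFact q n) * h2
    - (-1) ^ m * (-1) ^ n * qFact q (m + n) *
      (qFact q⁻¹ m * q ^ (∑ i ∈ Finset.range m, (i + 1))) * h3

/-! ### The Bailey chain -/

/-- The `q`-Chu–Vandermonde sum behind the Bailey chain. Splitting
`1 - q ^ n = (1 - q ^ (n - k)) + q ^ (n - k) (1 - q ^ k)` gives the recursion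
`(1 - q ^ n) S(n, m) = S(n - 1, m) + q ^ (n + m) S(n - 1, m + 1)`. -/
theorem sum_pow_div_qFact {q : ℂ} (hq : ‖q‖ < 1) (n m : ℕ) :
    ∑ k ∈ Finset.range (n + 1),
        q ^ (k * (k + m)) / (qFact q (n - k) * (qFact q k * qFact q (k + m))) =
      1 / (qFact q n * qFact q (n + m)) := by
  induction n generalizing m with
  | zero => simp [qFact_zero]
  | succ n ih =>
    have hn := one_sub_pow_succ_ne_zero hq n
    apply mul_left_cancel₀ hn
    have hA : ∀ k ∈ Finset.range (n + 1 + 1),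
        (1 - q ^ (n + 1)) *
          (q ^ (k * (k + m)) / (qFact q (n + 1 - k) * (qFact q k * qFact q (k + m)))) =
        (1 - q ^ (n + 1 - k)) *
          (q ^ (k * (k + m)) / (qFact q (n + 1 - k) * (qFact q k * qFact q (k + m)))) +
        (1 - q ^ k) * (q ^ (n + 1 - k) *
          (q ^ (k * (k + m)) / (qFact q (n + 1 - k) * (qFact q k * qFact q (k + m))))) := by
      intro k hk
      have hk' : k ≤ n + 1 := by
        have := Finset.mem_range.1 hk
        omega
      have : q ^ (n + 1) = q ^ (n + 1 - k) * q ^ k := by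
        rw [← pow_add, Nat.sub_add_cancel hk']
      rw [this]
      ring
    rw [Finset.mul_sum, Finset.sum_congr rfl hA, Finset.sum_add_distrib]
    -- Dividing `1 - q ^ (n + 1 - k)` out of `(q)_{n + 1 - k}` lowers `n`.
    have hB : ∑ k ∈ Finset.range (n + 1 + 1), (1 - q ^ (n + 1 - k)) *
          (q ^ (k * (k + m)) / (qFact q (n + 1 - k) * (qFact q k * qFact q (k + m)))) =
        1 / (qFact q n * qFact q (n + m)) := by
      rw [Finset.sum_range_succ, ← ih m]
      simp only [Nat.sub_self, pow_zero, sub_self, zero_mul, add_zero]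
      refine Finset.sum_congr rfl fun k hk => ?_
      have hk' : n + 1 - k = n - k + 1 := by
        have := Finset.mem_range.1 hk
        omega
      have h1 := one_sub_pow_succ_ne_zero hq (n - k)
      have h2 := qFact_ne_zero hq (n - k)
      have h3 := qFact_ne_zero hq k
      have h4 := qFact_ne_zero hq (k + m)
      rw [hk', qFact_succ]
      field_simp
    -- Dividing `1 - q ^ k` out of `(q)_k` and shifting `k` lowers `n` and raises `m`.
    have hC : ∑ k ∈ Finset.range (n + 1 + 1), (1 - q ^ k) * (q ^ (n + 1 - k) *
          (q ^ (k * (k + m)) / (qFact q (n + 1 - k) * (qFact q k * qFact q (k + m))))) =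
        q ^ (n + 1 + m) * (1 / (qFact q n * qFact q (n + (m + 1)))) := by
      rw [Finset.sum_range_succ', ← ih (m + 1), Finset.mul_sum]
      simp only [pow_zero, sub_self, zero_mul, add_zero]
      refine Finset.sum_congr rfl fun k hk => ?_
      have hk' : n + 1 - (k + 1) = n - k := by omega
      have hk2 : k ≤ n := by
        have := Finset.mem_range.1 hk
        omega
      have h1 := one_sub_pow_succ_ne_zero hq k
      have h2 := qFact_ne_zero hq (n - k)
      have h3 := qFact_ne_zero hq k
      have h4 := qFact_ne_zero hq (k + 1 + m)
      have hp : q ^ (n - k) * q ^ ((k + 1) * (k + 1 + m)) =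
          q ^ (n + 1 + m) * q ^ (k * (k + (m + 1))) := by
        rw [← pow_add, ← pow_add]
        congr 1
        obtain ⟨d, rfl⟩ := Nat.exists_eq_add_of_le hk2
        rw [Nat.add_sub_cancel_left]
        ring
      rw [hk', qFact_succ q k, show k + (m + 1) = k + 1 + m by ring]
      rw [show k + (m + 1) = k + 1 + m by ring] at hp
      field_simp
      linear_combination hp
    have h1 := qFact_ne_zero hq n
    have h2 := qFact_ne_zero hq (n + m)
    have h3 := one_sub_pow_succ_ne_zero hq (n + m)
    rw [hB, hC, ← add_assoc, qFact_succ q n, show n + 1 + m = n + m + 1 by ring,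
      qFact_succ q (n + m)]
    field_simp
    ring

/-- The Bailey lemma relative to `q ^ lam` with both free parameters sent to infinity. -/
theorem IsBaileyPair.chainStep {q : ℂ} (hq : ‖q‖ < 1) {lam : ℕ} {α β : ℕ → ℂ}
    (h : IsBaileyPair q (q ^ lam) α β) :
    IsBaileyPair q (q ^ lam) (fun L => q ^ (L * (L + lam)) * α L) (chainStep q lam β) := by
  intro L
  have h1 : ∀ i ∈ Finset.range (L + 1), q ^ (i * (i + lam)) / qFact q (L - i) * β i =
      ∑ r ∈ Finset.range (i + 1), q ^ (i * (i + lam)) / qFact q (L - i) *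
        (α r / (qFact q (i - r) * qShifted (q ^ lam * q) q (i + r))) := fun i _ => by
    rw [h i, Finset.mul_sum]
  rw [_root_.chainStep, Finset.sum_congr rfl h1,
    Finset.sum_comm' (t' := Finset.range (L + 1)) (s' := fun r => Finset.Ico r (L + 1))
      (fun x y => by simp only [Finset.mem_range, Finset.mem_Ico]; omega)]
  refine Finset.sum_congr rfl fun r hr => ?_
  have hr' : r ≤ L := by
    have := Finset.mem_range.1 hr
    omega
  -- The coefficient of `α_r` is a Chu–Vandermonde sum over `k = i - r`.
  have key := sum_pow_div_qFact hq (L - r) (2 * r + lam)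
  have e1 : L + 1 - r = L - r + 1 := by omega
  rw [Finset.sum_Ico_eq_sum_range, e1, qShifted_eq_div hq,
    show lam + (L + r) = L - r + (2 * r + lam) by omega]
  have h2 : q ^ (r * (r + lam)) * α r /
      (qFact q (L - r) * (qFact q (L - r + (2 * r + lam)) / qFact q lam)) =
      q ^ (r * (r + lam)) * α r * qFact q lam *
        (1 / (qFact q (L - r) * qFact q (L - r + (2 * r + lam)))) := by
    have := qFact_ne_zero hq lam
    have := qFact_ne_zero hq (L - r)
    have := qFact_ne_zero hq (L - r + (2 * r + lam))
    field_simp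
  rw [h2, ← key, Finset.mul_sum]
  refine Finset.sum_congr rfl fun k _ => ?_
  have e2 : L - (r + k) = L - r - k := by omega
  have e3 : r + k - r = k := by omega
  have e4 : lam + (r + k + r) = k + (2 * r + lam) := by ring
  have e5 : (r + k) * (r + k + lam) = r * (r + lam) + k * (k + (2 * r + lam)) := by ring
  rw [qShifted_eq_div hq, e2, e3, e4, e5, pow_add]
  have := qFact_ne_zero hq lam
  have := qFact_ne_zero hq k
  have := qFact_ne_zero hq (L - r - k)
  have := qFact_ne_zero hq (k + (2 * r + lam))
  field_simp

/-! ### The sequences `α` as sums over `ℤ` -/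

/-- The solution `L` of `2 L + lam = |d|`; the rounding of the division and the truncation at `0` are
immaterial under the hypotheses of `two_mul_baileyIndex`. -/
def baileyIndex (lam d : ℤ) : ℕ := ((|d| - lam) / 2).toNat

/-- Index of the `j`-th positive term: `2 L + |b - s| = |2 j p' + b - s|`. -/
def posIndex (p' b s j : ℤ) : ℕ := baileyIndex |b - s| (2 * j * p' + (b - s))

/-- Index of the `j`-th negative term: `2 L + |b - s| = |2 j p' + b + s|`. -/
def negIndex (p' b s j : ℤ) : ℕ := baileyIndex |b - s| (2 * j * p' + (b + s))

/-- Exponent of the `j`-th positive term of `alphaSeq`. -/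
def posExp (p' s P R j : ℤ) : ℤ := j * (j * p' * P + R * p' - s * P)

/-- Exponent of the `j`-th negative term of `alphaSeq`. -/
def negExp (p' s P R j : ℤ) : ℤ := (j * P + R) * (j * p' + s)

theorem two_mul_baileyIndex {lam d : ℤ} (h : (2 : ℤ) ∣ d - lam) (hle : lam ≤ |d|) :
    2 * (baileyIndex lam d : ℤ) + lam = |d| := by
  unfold baileyIndex
  rcases abs_cases d with ⟨h1, _⟩ | ⟨h1, _⟩ <;> rw [h1] at hle ⊢ <;> omega

section

variable {p' b s : ℤ}

theorem two_mul_posIndex (hs : 1 ≤ s ∧ s ≤ p' - 1) (hb : 1 ≤ b ∧ b ≤ p' - 1) (j : ℤ) :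
    2 * (posIndex p' b s j : ℤ) + |b - s| = |2 * j * p' + (b - s)| := by
  apply two_mul_baileyIndex
  · rw [show 2 * j * p' = 2 * (j * p') by ring]
    rcases abs_cases (b - s) with ⟨h1, _⟩ | ⟨h1, _⟩ <;> rw [h1] <;> omega
  · rcases lt_trichotomy j 0 with hj | hj | hj
    · have : j * p' ≤ -p' := by nlinarith
      rcases abs_cases (b - s) with ⟨h1, _⟩ | ⟨h1, _⟩ <;>
      rcases abs_cases (2 * j * p' + (b - s)) with ⟨h2, _⟩ | ⟨h2, _⟩ <;> rw [h1, h2] <;> linarith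
    · simp [hj]
    · have : p' ≤ j * p' := by nlinarith
      rcases abs_cases (b - s) with ⟨h1, _⟩ | ⟨h1, _⟩ <;>
      rcases abs_cases (2 * j * p' + (b - s)) with ⟨h2, _⟩ | ⟨h2, _⟩ <;> rw [h1, h2] <;> linarith

theorem two_mul_negIndex (hs : 1 ≤ s ∧ s ≤ p' - 1) (hb : 1 ≤ b ∧ b ≤ p' - 1) (j : ℤ) :
    2 * (negIndex p' b s j : ℤ) + |b - s| = |2 * j * p' + (b + s)| := by
  apply two_mul_baileyIndex
  · rw [show 2 * j * p' = 2 * (j * p') by ring]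
    rcases abs_cases (b - s) with ⟨h1, _⟩ | ⟨h1, _⟩ <;> rw [h1] <;> omega
  · rcases lt_or_ge j 0 with hj | hj
    · have : j * p' ≤ -p' := by nlinarith
      rcases abs_cases (b - s) with ⟨h1, _⟩ | ⟨h1, _⟩ <;>
      rcases abs_cases (2 * j * p' + (b + s)) with ⟨h2, _⟩ | ⟨h2, _⟩ <;> rw [h1, h2] <;> linarith
    · have : 0 ≤ j * p' := by nlinarith
      rcases abs_cases (b - s) with ⟨h1, _⟩ | ⟨h1, _⟩ <;>
      rcases abs_cases (2 * j * p' + (b + s)) with ⟨h2, _⟩ | ⟨h2, _⟩ <;> rw [h1, h2] <;> linarith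

theorem finite_posIndex_le (hs : 1 ≤ s ∧ s ≤ p' - 1) (hb : 1 ≤ b ∧ b ≤ p' - 1) (L : ℕ) :
    {j | posIndex p' b s j ≤ L}.Finite := by
  refine (Set.finite_Icc (-(2 * L + 2 * |b - s| : ℤ)) (2 * L + 2 * |b - s|)).subset fun j hj => ?_
  have h := two_mul_posIndex hs hb j
  have hj' : (posIndex p' b s j : ℤ) ≤ L := by exact_mod_cast hj
  have h1 := abs_le.1 (show |2 * j * p' + (b - s)| ≤ 2 * L + |b - s| by linarith)
  have h2 := neg_abs_le (b - s)
  have h3 := le_abs_self (b - s)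
  constructor <;> nlinarith

theorem finite_negIndex_le (hs : 1 ≤ s ∧ s ≤ p' - 1) (hb : 1 ≤ b ∧ b ≤ p' - 1) (L : ℕ) :
    {j | negIndex p' b s j ≤ L}.Finite := by
  refine (Set.finite_Icc (-(2 * L + |b - s| + (b + s) : ℤ)) (2 * L + |b - s| + (b + s))).subset
    fun j hj => ?_
  have h := two_mul_negIndex hs hb j
  have hj' : (negIndex p' b s j : ℤ) ≤ L := by exact_mod_cast hj
  have h1 := abs_le.1 (show |2 * j * p' + (b + s)| ≤ 2 * L + |b - s| by linarith)
  constructor <;> nlinarith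

theorem tsum_int_eq_add {f : ℤ → ℂ} (hf : f.support.Finite) :
    ∑' j, f j = f 0 + (∑' j, if 1 ≤ j then f j else 0) + ∑' j, if 1 ≤ j then f (-j) else 0 := by
  have e : ∀ j, f j = ((if j = 0 then f 0 else 0) + if 1 ≤ j then f j else 0) +
      if 1 ≤ -j then f j else 0 := by
    intro j
    rcases lt_trichotomy j 0 with hj | hj | hj
    · simp [hj.ne, show ¬ (1 ≤ j) by omega, show 1 ≤ -j by omega]
    · simp [hj]
    · simp [hj.ne', show 1 ≤ j by omega, show ¬ (1 ≤ -j) by omega]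
  have s1 : Summable fun j : ℤ => if j = 0 then f 0 else 0 :=
    summable_of_hasFiniteSupport ((Set.finite_singleton (0 : ℤ)).subset fun j hj => by
      by_contra h
      exact hj (if_neg h))
  have s2 : Summable fun j : ℤ => if 1 ≤ j then f j else 0 :=
    summable_of_hasFiniteSupport (hf.subset fun j hj h => hj (by simp [h]))
  have s3 : Summable fun j : ℤ => if 1 ≤ -j then f j else 0 :=
    summable_of_hasFiniteSupport (hf.subset fun j hj h => hj (by simp [h]))
  rw [tsum_congr e, (s1.add s2).tsum_add s3, s1.tsum_add s2, tsum_ite_eq]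
  congr 1
  rw [← (Equiv.neg ℤ).tsum_eq]
  simp

/-- The five contributions to `alphaSeq` merge into one positive and one negative sum over all
integers; the term `1` at `L = 0` is the term `j = 0` of the first of them. -/
theorem alphaSeq_eq (hs : 1 ≤ s ∧ s ≤ p' - 1) (hb : 1 ≤ b ∧ b ≤ p' - 1) (q : ℂ) (P R : ℤ)
    (L : ℕ) :
    alphaSeq q p' b s P R L =
      (∑' j : ℤ, if posIndex p' b s j = L then q ^ posExp p' s P R j else 0) -
      ∑' j : ℤ, if negIndex p' b s j = L then q ^ negExp p' s P R j else 0 := by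
  have f1 : (Function.support fun j : ℤ =>
      if posIndex p' b s j = L then q ^ posExp p' s P R j else 0).Finite :=
    (finite_posIndex_le hs hb L).subset fun j hj => by
      by_contra h
      exact hj (if_neg fun h' => h h'.le)
  have f2 : (Function.support fun j : ℤ =>
      if negIndex p' b s j = L then q ^ negExp p' s P R j else 0).Finite :=
    (finite_negIndex_le hs hb L).subset fun j hj => by
      by_contra h
      exact hj (if_neg fun h' => h h'.le)
  have pos : ∀ j : ℤ, 1 ≤ j → p' ≤ j * p' := fun j hj => by nlinarith
  have c1 : (if posIndex p' b s 0 = L then q ^ posExp p' s P R 0 else 0) =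
      if L = 0 then 1 else 0 := by
    have h := two_mul_posIndex hs hb 0
    simp only [mul_zero, zero_mul, zero_add] at h
    have : posIndex p' b s 0 = 0 := by omega
    simp [this, posExp, eq_comm]
  have c2 : ∀ j : ℤ, (if 1 ≤ j then
        (if posIndex p' b s j = L then q ^ posExp p' s P R j else 0) else 0) =
      if 1 ≤ j ∧ 2 * (L : ℤ) = 2 * j * p' - (|b - s| - b + s) then
        q ^ (j * (j * p' * P + R * p' - s * P)) else 0 := by
    intro j
    by_cases hj : 1 ≤ j
    · have h := two_mul_posIndex hs hb j
      rw [abs_of_pos (show 0 < 2 * j * p' + (b - s) by linarith [pos j hj])] at h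
      have : posIndex p' b s j = L ↔ 2 * (L : ℤ) = 2 * j * p' - (|b - s| - b + s) := by omega
      simp [hj, this, posExp]
    · simp [hj]
  have c3 : ∀ j : ℤ, (if 1 ≤ j then
        (if posIndex p' b s (-j) = L then q ^ posExp p' s P R (-j) else 0) else 0) =
      if 1 ≤ j ∧ 2 * (L : ℤ) = 2 * j * p' - (|b - s| + b - s) then
        q ^ (j * (j * p' * P - R * p' + s * P)) else 0 := by
    intro j
    by_cases hj : 1 ≤ j
    · have h := two_mul_posIndex hs hb (-j)
      rw [abs_of_neg (show 2 * -j * p' + (b - s) < 0 by linarith [pos j hj])] at h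
      have h' : 2 * -j * p' = -(2 * j * p') := by ring
      have : posIndex p' b s (-j) = L ↔ 2 * (L : ℤ) = 2 * j * p' - (|b - s| + b - s) := by omega
      have e : posExp p' s P R (-j) = j * (j * p' * P - R * p' + s * P) := by
        unfold posExp
        ring
      simp [hj, this, e]
    · simp [hj]
  have c4 : (if negIndex p' b s 0 = L then q ^ negExp p' s P R 0 else 0) +
      (∑' j : ℤ, if 1 ≤ j then
        (if negIndex p' b s j = L then q ^ negExp p' s P R j else 0) else 0) =
      ∑' j : ℤ, if 0 ≤ j ∧ 2 * (L : ℤ) = 2 * j * p' - (|b - s| - b - s) then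
        q ^ ((j * P + R) * (j * p' + s)) else 0 := by
    have s1 : Summable fun j : ℤ => if 1 ≤ j then
        (if negIndex p' b s j = L then q ^ negExp p' s P R j else 0) else 0 :=
      summable_of_hasFiniteSupport (f2.subset fun j hj h => hj (by
        simp only at h
        simp [h]))
    have s2 : Summable fun j : ℤ => if j = 0 then
        (if negIndex p' b s 0 = L then q ^ negExp p' s P R 0 else 0) else 0 :=
      summable_of_hasFiniteSupport ((Set.finite_singleton (0 : ℤ)).subset fun j hj => by
        by_contra h
        exact hj (if_neg h))
    rw [← tsum_ite_eq (0 : ℤ) (fun _ => if negIndex p' b s 0 = L then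
      q ^ negExp p' s P R 0 else 0), ← s2.tsum_add s1]
    refine tsum_congr fun j => ?_
    by_cases hj : 0 ≤ j
    · have h := two_mul_negIndex hs hb j
      rw [abs_of_pos (show 0 < 2 * j * p' + (b + s) by nlinarith)] at h
      have : negIndex p' b s j = L ↔ 2 * (L : ℤ) = 2 * j * p' - (|b - s| - b - s) := by omega
      have e : 0 ≤ j ∧ 2 * (L : ℤ) = 2 * j * p' - (|b - s| - b - s) ↔ negIndex p' b s j = L := by
        rw [this]
        exact and_iff_right hj
      rw [if_congr e rfl rfl]
      rcases hj.eq_or_lt with h0 | h0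
      · subst h0
        simp [negExp]
      · simp [h0.ne', show 1 ≤ j by omega, negExp]
    · simp [hj, show j ≠ 0 by omega, show ¬ 1 ≤ j by omega]
  have c5 : ∀ j : ℤ, (if 1 ≤ j then
        (if negIndex p' b s (-j) = L then q ^ negExp p' s P R (-j) else 0) else 0) =
      if 1 ≤ j ∧ 2 * (L : ℤ) = 2 * j * p' - (|b - s| + b + s) then
        q ^ ((j * P - R) * (j * p' - s)) else 0 := by
    intro j
    by_cases hj : 1 ≤ j
    · have h := two_mul_negIndex hs hb (-j)
      rw [abs_of_neg (show 2 * -j * p' + (b + s) < 0 by linarith [pos j hj])] at h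
      have h' : 2 * -j * p' = -(2 * j * p') := by ring
      have : negIndex p' b s (-j) = L ↔ 2 * (L : ℤ) = 2 * j * p' - (|b - s| + b + s) := by omega
      have e : negExp p' s P R (-j) = (j * P - R) * (j * p' - s) := by
        unfold negExp
        ring
      simp [hj, this, e]
    · simp [hj]
  rw [tsum_int_eq_add f1, tsum_int_eq_add f2, c1, tsum_congr c2, tsum_congr c3, c4, tsum_congr c5,
    alphaSeq]
  ring

theorem hasSum_fiber_mul {ι : ℤ → ℕ} {f : ℤ → ℂ} {F : ℕ → ℂ}
    (h : Summable fun j => f j * F (ι j)) :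
    HasSum (fun L => (∑' j : ℤ, if ι j = L then f j else 0) * F L) (∑' j, f j * F (ι j)) := by
  have := h.hasSum.tsum_fiberwise ι
  refine (congrArg (HasSum · _) (funext fun L => ?_)).mpr this
  rw [tsum_subtype (ι ⁻¹' {L}) fun j => f j * F (ι j), ← tsum_mul_right]
  refine tsum_congr fun j => ?_
  by_cases hj : ι j = L
  · simp [Set.indicator, hj]
  · simp [Set.indicator, hj]

/-- A sum against `alphaSeq` is a difference of two sums over the integers. -/
theorem hasSum_alphaSeq_mul (hs : 1 ≤ s ∧ s ≤ p' - 1) (hb : 1 ≤ b ∧ b ≤ p' - 1) (q : ℂ) (P R : ℤ)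
    {F : ℕ → ℂ} (h1 : Summable fun j => q ^ posExp p' s P R j * F (posIndex p' b s j))
    (h2 : Summable fun j => q ^ negExp p' s P R j * F (negIndex p' b s j)) :
    HasSum (fun L => alphaSeq q p' b s P R L * F L)
      (∑' j, q ^ posExp p' s P R j * F (posIndex p' b s j) -
        ∑' j, q ^ negExp p' s P R j * F (negIndex p' b s j)) := by
  refine (congrArg (HasSum · _) (funext fun L => ?_)).mpr ((hasSum_fiber_mul h1).sub (hasSum_fiber_mul h2))
  rw [alphaSeq_eq hs hb, sub_mul]

theorem mul_add_baileyIndex {lam d : ℤ} {i : ℕ} (h : 2 * (i : ℤ) + |lam| = |d|) :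
    4 * ((i : ℤ) * (i + |lam|)) = d ^ 2 - lam ^ 2 := by
  rw [← sq_abs d, ← h, ← sq_abs lam]
  ring

theorem posIndex_mul_add (hs : 1 ≤ s ∧ s ≤ p' - 1) (hb : 1 ≤ b ∧ b ≤ p' - 1) (j : ℤ) :
    ((posIndex p' b s j * (posIndex p' b s j + (b - s).natAbs) : ℕ) : ℤ) = posExp p' s p' b j := by
  have := mul_add_baileyIndex (two_mul_posIndex hs hb j)
  have e : (2 * j * p' + (b - s)) ^ 2 - (b - s) ^ 2 = 4 * posExp p' s p' b j := by
    unfold posExp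
    ring
  rw [e] at this
  push_cast [Int.natCast_natAbs]
  omega

theorem negIndex_mul_add (hs : 1 ≤ s ∧ s ≤ p' - 1) (hb : 1 ≤ b ∧ b ≤ p' - 1) (j : ℤ) :
    ((negIndex p' b s j * (negIndex p' b s j + (b - s).natAbs) : ℕ) : ℤ) = negExp p' s p' b j := by
  have := mul_add_baileyIndex (two_mul_negIndex hs hb j)
  have e : (2 * j * p' + (b + s)) ^ 2 - (b - s) ^ 2 = 4 * negExp p' s p' b j := by
    unfold negExp
    ring
  rw [e] at this
  push_cast [Int.natCast_natAbs]
  omega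

/-- One step of the Bailey chain acts on `alphaSeq` by `(P, R) ↦ (P + p', R + b)`. -/
theorem alphaSeq_add (hs : 1 ≤ s ∧ s ≤ p' - 1) (hb : 1 ≤ b ∧ b ≤ p' - 1) {q : ℂ} (hq0 : q ≠ 0)
    (P R : ℤ) (L : ℕ) :
    alphaSeq q p' b s (P + p') (R + b) L =
      q ^ (L * (L + (b - s).natAbs)) * alphaSeq q p' b s P R L := by
  rw [alphaSeq_eq hs hb, alphaSeq_eq hs hb, mul_sub, ← tsum_mul_left, ← tsum_mul_left]
  congr 1 <;> refine tsum_congr fun j => ?_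
  · split_ifs with h
    · subst h
      rw [← zpow_natCast, posIndex_mul_add hs hb, ← zpow_add₀ hq0]
      congr 1
      unfold posExp
      ring
    · simp
  · split_ifs with h
    · subst h
      rw [← zpow_natCast, negIndex_mul_add hs hb, ← zpow_add₀ hq0]
      congr 1
      unfold negExp
      ring
    · simp

/-- Replacing `q` by `1/q` acts on `alphaSeq` by the duality `(P, R) ↦ (p' - P, b - R)`. -/
theorem alphaSeq_dual (hs : 1 ≤ s ∧ s ≤ p' - 1) (hb : 1 ≤ b ∧ b ≤ p' - 1) {q : ℂ} (hq0 : q ≠ 0)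
    (P R : ℤ) (L : ℕ) :
    alphaSeq q p' b s (p' - P) (b - R) L =
      q ^ (L * (L + (b - s).natAbs)) * alphaSeq q⁻¹ p' b s P R L := by
  rw [alphaSeq_eq hs hb, alphaSeq_eq hs hb, mul_sub, ← tsum_mul_left, ← tsum_mul_left]
  congr 1 <;> refine tsum_congr fun j => ?_
  · split_ifs with h
    · subst h
      rw [← zpow_natCast, posIndex_mul_add hs hb, inv_zpow', ← zpow_add₀ hq0]
      congr 1
      unfold posExp
      ring
    · simp
  · split_ifs with h
    · subst h
      rw [← zpow_natCast, negIndex_mul_add hs hb, inv_zpow', ← zpow_add₀ hq0]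
      congr 1
      unfold negExp
      ring
    · simp

/-! ### The Forrester–Baxter polynomials and their Bailey pairs -/

theorem qBinom_natCast (q : ℂ) (m n : ℕ) :
    qBinom q m n = qFact q (m + n) / (qFact q m * qFact q n) := by
  simp [qBinom]

theorem qBinom_of_neg (q : ℂ) {m n : ℚ} (h : m < 0 ∨ n < 0) : qBinom q m n = 0 := by
  rw [qBinom, if_neg]
  rintro ⟨h1, h2⟩
  rw [← h1, ← h2] at h
  have a1 : (0 : ℚ) ≤ (⌊m⌋₊ : ℚ) := Nat.cast_nonneg _
  have a2 : (0 : ℚ) ≤ (⌊n⌋₊ : ℚ) := Nat.cast_nonneg _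
  rcases h with h | h <;> linarith

/-- The `q`-binomial `[2 L + lam; L - i]`, read as `0` for `i > L`. -/
noncomputable def centralBinom (q : ℂ) (lam L i : ℕ) : ℂ :=
  if i ≤ L then qFact q (2 * L + lam) / (qFact q (L - i) * qFact q (L + i + lam)) else 0

theorem qBinom_eq_centralBinom (q : ℂ) {lam L i : ℕ} {d : ℤ} (h : 2 * (i : ℤ) + lam = |d|)
    {x : ℚ} (hx : x = ((2 * L + lam : ℕ) - (d : ℚ)) / 2) :
    qBinom q (((2 * L + lam : ℕ) : ℚ) - x) x = centralBinom q lam L i := by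
  have hQ : 2 * (i : ℚ) + lam = |(d : ℚ)| := by exact_mod_cast h
  unfold centralBinom
  push_cast at hx ⊢
  rcases abs_cases (d : ℚ) with ⟨h1, h2⟩ | ⟨h1, h2⟩ <;> rw [h1] at hQ <;> split_ifs with hi
  · have e1 : (2 * (L : ℚ) + lam - x) = (L + i + lam : ℕ) := by
      push_cast
      linarith
    have e2 : x = (L - i : ℕ) := by
      push_cast [hi]
      linarith
    rw [e1, e2, qBinom_natCast, mul_comm (qFact q (L - i)),
      show L + i + lam + (L - i) = 2 * L + lam by omega]
  · have hi' : (L : ℚ) < i := by exact_mod_cast not_le.1 hi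
    exact qBinom_of_neg _ (Or.inr (by linarith))
  · have e1 : (2 * (L : ℚ) + lam - x) = (L - i : ℕ) := by
      push_cast [hi]
      linarith
    have e2 : x = (L + i + lam : ℕ) := by
      push_cast
      linarith
    rw [e1, e2, qBinom_natCast, show L - i + (L + i + lam) = 2 * L + lam by omega]
  · have hi' : (L : ℚ) < i := by exact_mod_cast not_le.1 hi
    exact qBinom_of_neg _ (Or.inl (by linarith))

theorem bosonicB_eq_tsum (hs : 1 ≤ s ∧ s ≤ p' - 1) (hb : 1 ≤ b ∧ b ≤ p' - 1) (q : ℂ) (P R : ℤ)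
    (L : ℕ) :
    bosonicB q P p' R s (2 * L + (b - s).natAbs) b =
      ∑' j, (q ^ posExp p' s P R j * centralBinom q (b - s).natAbs L (posIndex p' b s j) -
        q ^ negExp p' s P R j * centralBinom q (b - s).natAbs L (negIndex p' b s j)) := by
  refine tsum_congr fun j => ?_
  have h1 := two_mul_posIndex hs hb j
  have h2 := two_mul_negIndex hs hb j
  rw [← Int.natCast_natAbs (b - s)] at h1 h2
  rw [qBinom_eq_centralBinom q h1 (by push_cast; ring),
    qBinom_eq_centralBinom q h2 (by push_cast; ring), posExp, negExp]
  congr 3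
  ring

theorem centralBinom_of_lt (q : ℂ) {lam L i : ℕ} (h : L < i) : centralBinom q lam L i = 0 :=
  if_neg (by omega)

theorem bosonicB_eq_sum (hs : 1 ≤ s ∧ s ≤ p' - 1) (hb : 1 ≤ b ∧ b ≤ p' - 1) (q : ℂ) (P R : ℤ)
    (L : ℕ) :
    bosonicB q P p' R s (2 * L + (b - s).natAbs) b =
      ∑ i ∈ Finset.range (L + 1), alphaSeq q p' b s P R i *
        (qFact q (2 * L + (b - s).natAbs) /
          (qFact q (L - i) * qFact q (L + i + (b - s).natAbs))) := by
  have h1 : Summable fun j => q ^ posExp p' s P R j *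
      centralBinom q (b - s).natAbs L (posIndex p' b s j) :=
    summable_of_hasFiniteSupport ((finite_posIndex_le hs hb L).subset fun j hj => by
      by_contra h
      exact hj (by simp [centralBinom_of_lt q (not_le.1 h)]))
  have h2 : Summable fun j => q ^ negExp p' s P R j *
      centralBinom q (b - s).natAbs L (negIndex p' b s j) :=
    summable_of_hasFiniteSupport ((finite_negIndex_le hs hb L).subset fun j hj => by
      by_contra h
      exact hj (by simp [centralBinom_of_lt q (not_le.1 h)]))
  rw [bosonicB_eq_tsum hs hb, h1.tsum_sub h2, ← (hasSum_alphaSeq_mul hs hb q P R h1 h2).tsum_eq,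
    tsum_eq_sum (s := Finset.range (L + 1)) fun i hi => by
      rw [centralBinom_of_lt q (by simpa using hi), mul_zero]]
  refine Finset.sum_congr rfl fun i hi => ?_
  rw [centralBinom, if_pos (by simpa [Nat.lt_succ_iff] using hi)]

theorem isBaileyPair_zero (hs : 1 ≤ s ∧ s ≤ p' - 1) (hb : 1 ≤ b ∧ b ≤ p' - 1) {q : ℂ}
    (hq : ‖q‖ < 1) (p r : ℤ) :
    IsBaileyPair q (q ^ (b - s).natAbs) (alphaSeq q p' b s p r) (betaBP q p p' r s b 0) := by
  intro L
  simp only [betaBP]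
  rw [bosonicB_eq_sum hs hb, Finset.mul_sum]
  refine Finset.sum_congr rfl fun i _ => ?_
  rw [qShifted_eq_div hq, show (b - s).natAbs + (L + i) = L + i + (b - s).natAbs by ring]
  have := qFact_ne_zero hq (b - s).natAbs
  have := qFact_ne_zero hq (L + i + (b - s).natAbs)
  have := qFact_ne_zero hq (2 * L + (b - s).natAbs)
  have := qFact_ne_zero hq (L - i)
  field_simp

theorem isBaileyPair_dual_zero (hs : 1 ≤ s ∧ s ≤ p' - 1) (hb : 1 ≤ b ∧ b ≤ p' - 1) {q : ℂ}
    (hq : ‖q‖ < 1) (hq0 : q ≠ 0) (p r : ℤ) :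
    IsBaileyPair q (q ^ (b - s).natAbs) (alphaSeq q p' b s (p' - p) (b - r))
      (betaDualBP q p p' r s b 0) := by
  intro L
  simp only [betaDualBP]
  rw [bosonicB_eq_sum hs hb, Finset.mul_sum]
  refine Finset.sum_congr rfl fun i hi => ?_
  have hi' : i ≤ L := by
    have := Finset.mem_range.1 hi
    omega
  have key := qFact_inv_div hq hq0 (L - i) (L + i + (b - s).natAbs)
  rw [show L - i + (L + i + (b - s).natAbs) = 2 * L + (b - s).natAbs by omega] at key
  have hpow : L * (L + (b - s).natAbs) =
      (L - i) * (L + i + (b - s).natAbs) + i * (i + (b - s).natAbs) := by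
    obtain ⟨c, rfl⟩ := Nat.exists_eq_add_of_le hi'
    rw [Nat.add_sub_cancel_left]
    ring
  rw [alphaSeq_dual hs hb hq0, qShifted_eq_div hq,
    show (b - s).natAbs + (L + i) = L + i + (b - s).natAbs by ring, hpow, pow_add]
  have := qFact_ne_zero hq (b - s).natAbs
  have := qFact_ne_zero hq (L + i + (b - s).natAbs)
  have := qFact_ne_zero hq (2 * L + (b - s).natAbs)
  have := qFact_ne_zero hq (L - i)
  calc _ = q ^ (i * (i + (b - s).natAbs)) * alphaSeq q⁻¹ p' b s p r i *
        (qFact q (b - s).natAbs / qFact q (2 * L + (b - s).natAbs)) *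
        (q ^ ((L - i) * (L + i + (b - s).natAbs)) * (qFact q⁻¹ (2 * L + (b - s).natAbs) /
          (qFact q⁻¹ (L - i) * qFact q⁻¹ (L + i + (b - s).natAbs)))) := by ring
    _ = _ := by
      rw [key]
      field_simp

theorem isBaileyPair_alphaBP (hs : 1 ≤ s ∧ s ≤ p' - 1) (hb : 1 ≤ b ∧ b ≤ p' - 1) {q : ℂ}
    (hq : ‖q‖ < 1) (hq0 : q ≠ 0) (p r : ℤ) (k : ℕ) :
    IsBaileyPair q (q ^ (b - s).natAbs) (alphaBP q p p' r s b k) (betaBP q p p' r s b k) := by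
  induction k with
  | zero => simpa [alphaBP] using isBaileyPair_zero hs hb hq p r
  | succ k ih =>
    refine (congrArg (IsBaileyPair q _ · _) (funext fun L => ?_)).mpr (ih.chainStep hq)
    rw [alphaBP, alphaBP, ← alphaSeq_add hs hb hq0]
    push_cast
    congr 1 <;> ring

theorem isBaileyPair_alphaDualBP (hs : 1 ≤ s ∧ s ≤ p' - 1) (hb : 1 ≤ b ∧ b ≤ p' - 1) {q : ℂ}
    (hq : ‖q‖ < 1) (hq0 : q ≠ 0) (p r : ℤ) (k : ℕ) :
    IsBaileyPair q (q ^ (b - s).natAbs) (alphaDualBP q p p' r s b k)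
      (betaDualBP q p p' r s b k) := by
  induction k with
  | zero => simpa [alphaDualBP] using isBaileyPair_dual_zero hs hb hq hq0 p r
  | succ k ih =>
    refine (congrArg (IsBaileyPair q _ · _) (funext fun L => ?_)).mpr (ih.chainStep hq)
    rw [alphaDualBP, alphaDualBP, ← alphaSeq_add hs hb hq0]
    push_cast
    congr 1 <;> ring

end

/-! ### A reflection symmetry of sums over the lattice `ℤ ^ N` -/

/-- `1 / (q)_m` for an integer `m`, equal to `0` for `m < 0`. -/
noncomputable def invQFact (q : ℂ) (m : ℤ) : ℂ := if m < 0 then 0 else (qFact q m.toNat)⁻¹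

theorem invQFact_natCast (q : ℂ) (m : ℕ) : invQFact q m = (qFact q m)⁻¹ := by
  simp [invQFact]

theorem invQFact_sub_one {q : ℂ} (hq : ‖q‖ < 1) (m : ℤ) :
    invQFact q (m - 1) = (1 - q ^ m) * invQFact q m := by
  rcases lt_trichotomy m 0 with h | h | h
  · simp [invQFact, h, show m - 1 < 0 by omega]
  · simp [h, invQFact]
  · obtain ⟨k, rfl⟩ : ∃ k : ℕ, m = (k + 1 : ℕ) := ⟨(m - 1).toNat, by omega⟩
    rw [show ((k + 1 : ℕ) : ℤ) - 1 = (k : ℕ) by push_cast; ring, invQFact_natCast,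
      invQFact_natCast, qFact_succ, zpow_natCast]
    have := one_sub_pow_succ_ne_zero hq k
    have := qFact_ne_zero hq k
    field_simp

/-- The entry `0` or `1` of a `0`-`1` vector encoded by Booleans. -/
def bit (a : Bool) : ℤ := if a then 1 else 0

/-- `1` if the consecutive entries `a, b` of a `0`-`1` vector form an ascent `0, 1`. -/
def ascent (a b : Bool) : ℤ := if !a && b then 1 else 0

/-- The number of ones of a `0`-`1` vector. -/
def bitCount {n : ℕ} (ε : Fin n → Bool) : ℤ := ∑ i, bit (ε i)

/-- The monomial of the ones of `ε` times a factor `1 - u_i / u_{i+1}` for each ascent. -/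
noncomputable def ascentWeight {n : ℕ} (u : Fin (n + 1) → ℂ) (ε : Fin (n + 1) → Bool) : ℂ :=
  (∏ i, u i ^ bit (ε i)) *
    ∏ i : Fin n, (1 - u i.castSucc / u i.succ) ^ ascent (ε i.castSucc) (ε i.succ)

/-- The product of the last `ℓ` of `n` variables, and `0` unless `0 ≤ ℓ ≤ n`. -/
noncomputable def lastProd {n : ℕ} (ℓ : ℤ) (u : Fin n → ℂ) : ℂ :=
  if 0 ≤ ℓ ∧ ℓ ≤ n then ∏ i : Fin n, (if (n : ℤ) ≤ i + ℓ then u i else 1) else 0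

theorem lastProd_succ_of_ne {n : ℕ} {ℓ : ℤ} (h : ℓ ≠ n + 1) (u : Fin (n + 1) → ℂ) :
    lastProd ℓ u = lastProd ℓ (Fin.tail u) := by
  unfold lastProd
  by_cases h0 : 0 ≤ ℓ ∧ ℓ ≤ n
  · rw [if_pos h0, if_pos ⟨h0.1, by push_cast; omega⟩, Fin.prod_univ_succ, if_neg]
    · rw [one_mul]
      refine Finset.prod_congr rfl fun i _ => ?_
      simp only [Fin.tail, Fin.val_succ]
      refine if_congr ?_ rfl rfl
      push_cast
      omega
    · push_cast
      simp
      omega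
  · rw [if_neg h0, if_neg]
    push_cast
    omega

theorem lastProd_succ_self {n : ℕ} (u : Fin (n + 1) → ℂ) :
    lastProd (n + 1) u = u 0 * lastProd n (Fin.tail u) := by
  unfold lastProd
  rw [if_pos ⟨by positivity, by push_cast; omega⟩, if_pos ⟨by positivity, le_rfl⟩,
    Fin.prod_univ_succ]
  congr 1
  · simp
  · refine Finset.prod_congr rfl fun i _ => ?_
    simp only [Fin.tail, Fin.val_succ]
    refine if_congr ?_ rfl rfl
    push_cast
    omega

theorem lastProd_of_lt {n : ℕ} {ℓ : ℤ} (h : (n : ℤ) < ℓ) (u : Fin n → ℂ) : lastProd ℓ u = 0 :=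
  if_neg (by omega)

theorem sum_bool_fun_succ {n : ℕ} (f : (Fin (n + 1) → Bool) → ℂ) :
    ∑ ε, f ε = (∑ ε : Fin n → Bool, f (Fin.cons true ε)) +
      ∑ ε : Fin n → Bool, f (Fin.cons false ε) := by
  rw [← (Fin.consEquiv fun _ => Bool).sum_comp, Fintype.sum_prod_type]
  simp [Fin.consEquiv]

theorem bitCount_cons {n : ℕ} (a : Bool) (ε : Fin n → Bool) :
    bitCount (Fin.cons a ε : Fin (n + 1) → Bool) = bit a + bitCount ε := by
  simp [bitCount, Fin.sum_univ_succ]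

theorem ascentWeight_cons {n : ℕ} (u : Fin (n + 2) → ℂ) (a : Bool) (ε : Fin (n + 1) → Bool) :
    ascentWeight u (Fin.cons a ε : Fin (n + 2) → Bool) =
      u 0 ^ bit a * (1 - u 0 / u 1) ^ ascent a (ε 0) * ascentWeight (Fin.tail u) ε := by
  simp only [ascentWeight, Fin.prod_univ_succ (n := n + 1), Fin.prod_univ_succ (n := n),
    Fin.cons_zero, Fin.cons_succ, Fin.castSucc_zero,
    ← Fin.succ_castSucc, Fin.tail, Fin.succ_zero_eq_one]
  ring

/-- The two halves of the identity `sum_ascentWeight`, according to the first entry of `ε`. -/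
theorem sum_ascentWeight_cons {n : ℕ} (u : Fin (n + 1) → ℂ) (hu : ∀ i, u i ≠ 0) (ℓ : ℤ) :
    (∑ ε : Fin n → Bool, if bitCount (Fin.cons true ε : Fin (n + 1) → Bool) = ℓ then
        ascentWeight u (Fin.cons true ε : Fin (n + 1) → Bool) else 0) =
      u 0 * lastProd (ℓ - 1) (Fin.tail u) ∧
    (∑ ε : Fin n → Bool, if bitCount (Fin.cons false ε : Fin (n + 1) → Bool) = ℓ then
        ascentWeight u (Fin.cons false ε : Fin (n + 1) → Bool) else 0) =
      lastProd ℓ u - u 0 * lastProd (ℓ - 1) (Fin.tail u) := by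
  induction n generalizing ℓ with
  | zero =>
    have h1 : lastProd (ℓ - 1) (Fin.tail u) = if ℓ = 1 then 1 else 0 := by
      unfold lastProd
      refine if_congr ?_ (by simp) rfl
      push_cast
      omega
    have h2 : lastProd ℓ u - u 0 * lastProd (ℓ - 1) (Fin.tail u) = if ℓ = 0 then 1 else 0 := by
      rw [h1]
      by_cases h : ℓ = 1
      · rw [h, if_pos rfl, show (1 : ℤ) = ((0 : ℕ) : ℤ) + 1 by simp, lastProd_succ_self]
        simp [lastProd]
      · rw [if_neg h, lastProd_succ_of_ne (by simpa using h)]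
        unfold lastProd
        rw [mul_zero, sub_zero]
        refine if_congr ?_ (by simp) rfl
        push_cast
        omega
    have h3 : ∀ ε : Fin 0 → Bool, bitCount ε = 0 := fun ε => by simp [bitCount]
    rw [h2, h1, Fintype.sum_unique, Fintype.sum_unique, bitCount_cons, bitCount_cons, h3]
    constructor
    · simp [bit, ascentWeight, @eq_comm ℤ _ ℓ]
    · simp [bit, ascentWeight, @eq_comm ℤ _ ℓ]
  | succ n ih =>
    have hu' : ∀ i, Fin.tail u i ≠ 0 := fun i => hu i.succ
    have key : ∀ (a : Bool) (ε : Fin (n + 1) → Bool),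
        (if bitCount (Fin.cons a ε : Fin (n + 2) → Bool) = ℓ then
          ascentWeight u (Fin.cons a ε : Fin (n + 2) → Bool) else 0) =
        (u 0 ^ bit a * (1 - u 0 / u 1) ^ ascent a (ε 0)) *
          if bitCount ε = ℓ - bit a then ascentWeight (Fin.tail u) ε else 0 := by
      intro a ε
      rw [bitCount_cons, ascentWeight_cons, mul_ite, mul_zero]
      exact if_congr (by constructor <;> intro h <;> linarith) rfl rfl
    simp only [key]
    constructor
    · have h := ih (Fin.tail u) hu' (ℓ - 1)
      simp only [bit, ascent, if_true, zpow_one, Bool.not_true, Bool.false_and, Bool.false_eq_true,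
        if_false, zpow_zero, mul_one]
      rw [← Finset.mul_sum, sum_bool_fun_succ, h.1, h.2]
      ring
    · have h := ih (Fin.tail u) hu' ℓ
      rw [sum_bool_fun_succ]
      simp only [bit, ascent, if_true, zpow_one, Bool.not_false, Bool.true_and, Bool.false_eq_true,
        if_false, zpow_zero, one_mul, Fin.cons_zero, sub_zero]
      rw [← Finset.mul_sum, h.1, h.2, show Fin.tail u 0 = u 1 from rfl]
      have h1 : u 1 ≠ 0 := hu 1
      have e : (1 - u 0 / u 1) * (u 1 * lastProd (ℓ - 1) (Fin.tail (Fin.tail u))) +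
          (lastProd ℓ (Fin.tail u) - u 1 * lastProd (ℓ - 1) (Fin.tail (Fin.tail u))) =
          lastProd ℓ (Fin.tail u) - u 0 * lastProd (ℓ - 1) (Fin.tail (Fin.tail u)) := by
        field_simp
        ring
      rw [e]
      by_cases hl : ℓ = ((n + 1 : ℕ) : ℤ) + 1
      · rw [hl, lastProd_succ_self, add_sub_cancel_right, lastProd_of_lt (by omega),
          lastProd_of_lt (by push_cast; omega)]
        ring
      · rw [lastProd_succ_of_ne hl u, lastProd_succ_of_ne (ℓ := ℓ - 1) (by omega) (Fin.tail u)]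

/-- The sum of `ascentWeight` over all `0`-`1` vectors with `ℓ` ones telescopes to the product of
the last `ℓ` variables. -/
theorem sum_ascentWeight {n : ℕ} (u : Fin (n + 1) → ℂ) (hu : ∀ i, u i ≠ 0) (ℓ : ℤ) :
    (∑ ε, if bitCount ε = ℓ then ascentWeight u ε else 0) = lastProd ℓ u := by
  rw [sum_bool_fun_succ, (sum_ascentWeight_cons u hu ℓ).1, (sum_ascentWeight_cons u hu ℓ).2]
  ring

/-- The summand `q ^ (∑ M_i ^ 2 + ∑ ε_i M_i) / ∏ (q)_{M_i - M_{i+1} - [ascent of ε at i]}`. -/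
noncomputable def latticeTerm (q : ℂ) {n : ℕ} (ε : Fin (n + 1) → Bool) (M : Fin (n + 1) → ℤ) : ℂ :=
  q ^ (∑ i, (M i ^ 2 + bit (ε i) * M i)) *
    ∏ i : Fin n, invQFact q (M i.castSucc - M i.succ - ascent (ε i.castSucc) (ε i.succ))

/-- The summand `q ^ (∑ M_i ^ 2 + M_{N-ℓ+1} + ⋯ + M_N) / ∏ (q)_{M_i - M_{i+1}}` with `N = n + 1`. -/
noncomputable def lastTerm (q : ℂ) {n : ℕ} (ℓ : ℤ) (M : Fin (n + 1) → ℤ) : ℂ :=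
  q ^ (∑ i, M i ^ 2) * lastProd ℓ (fun i => q ^ M i) *
    ∏ i : Fin n, invQFact q (M i.castSucc - M i.succ)

theorem zpow_sum {ι : Type*} {q : ℂ} (hq0 : q ≠ 0) (s : Finset ι) (f : ι → ℤ) :
    q ^ (∑ i ∈ s, f i) = ∏ i ∈ s, q ^ f i := by
  classical
  induction s using Finset.induction_on with
  | empty => simp
  | insert a s ha ih => rw [Finset.sum_insert ha, Finset.prod_insert ha, zpow_add₀ hq0, ih]

theorem latticeTerm_eq {q : ℂ} (hq : ‖q‖ < 1) (hq0 : q ≠ 0) {n : ℕ} (ε : Fin (n + 1) → Bool)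
    (M : Fin (n + 1) → ℤ) :
    latticeTerm q ε M = q ^ (∑ i, M i ^ 2) * ascentWeight (fun i => q ^ M i) ε *
      ∏ i : Fin n, invQFact q (M i.castSucc - M i.succ) := by
  have h1 : ∀ i : Fin n,
      invQFact q (M i.castSucc - M i.succ - ascent (ε i.castSucc) (ε i.succ)) =
      (1 - q ^ M i.castSucc / q ^ M i.succ) ^ ascent (ε i.castSucc) (ε i.succ) *
        invQFact q (M i.castSucc - M i.succ) := by
    intro i
    unfold ascent
    split_ifs
    · rw [invQFact_sub_one hq, zpow_sub₀ hq0, zpow_one]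
    · simp
  have h2 : ∀ i, q ^ (bit (ε i) * M i) = (q ^ M i) ^ bit (ε i) := fun i => by
    rw [mul_comm, zpow_mul]
  rw [latticeTerm, Finset.prod_congr rfl fun i _ => h1 i, Finset.prod_mul_distrib,
    Finset.sum_add_distrib, zpow_add₀ hq0, zpow_sum hq0 _ fun i => bit (ε i) * M i,
    Finset.prod_congr rfl fun i _ => h2 i, ascentWeight]
  ring

theorem sum_latticeTerm {q : ℂ} (hq : ‖q‖ < 1) (hq0 : q ≠ 0) {n : ℕ} (ℓ : ℤ)
    (M : Fin (n + 1) → ℤ) :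
    (∑ ε, if bitCount ε = ℓ then latticeTerm q ε M else 0) = lastTerm q ℓ M := by
  rw [lastTerm, ← sum_ascentWeight _ (fun i => zpow_ne_zero _ hq0), Finset.mul_sum, Finset.sum_mul]
  refine Finset.sum_congr rfl fun ε _ => ?_
  rw [latticeTerm_eq hq hq0]
  split_ifs <;> simp

/-- The reflection `M ↦ -rev (M + ε)` of `ℤ ^ N`. -/
def reflection {n : ℕ} (ε : Fin n → Bool) : (Fin n → ℤ) ≃ (Fin n → ℤ) where
  toFun M i := -(M i.rev + bit (ε i.rev))
  invFun M i := -M i.rev - bit (ε i)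
  left_inv M := by
    funext i
    simp
  right_inv M := by
    funext i
    simp

theorem sum_reflection {n : ℕ} (ε : Fin n → Bool) (M : Fin n → ℤ) :
    ∑ i, reflection ε M i = -(∑ i, M i) - bitCount ε := by
  simp only [reflection, Equiv.coe_fn_mk, bitCount]
  have h := Equiv.sum_comp Fin.revPerm (fun i => M i + bit (ε i))
  simp only [Fin.revPerm_apply] at h
  rw [Finset.sum_neg_distrib, h, Finset.sum_add_distrib]
  ring

/-- The reflection exchanges the ascents of `ε` with those of the reversed vector, and completing
the square shows that it preserves the exponent. -/
theorem latticeTerm_reflection (q : ℂ) {n : ℕ} (ε : Fin (n + 1) → Bool) (M : Fin (n + 1) → ℤ) :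
    latticeTerm q (ε ∘ Fin.rev) (reflection ε M) = latticeTerm q ε M := by
  unfold latticeTerm
  congr 1
  · congr 1
    rw [← Equiv.sum_comp Fin.revPerm (fun i => M i ^ 2 + bit (ε i) * M i)]
    refine Finset.sum_congr rfl fun i _ => ?_
    simp only [reflection, Equiv.coe_fn_mk, Function.comp, Fin.revPerm_apply, bit]
    split_ifs <;> ring
  · rw [← Equiv.prod_comp Fin.revPerm (fun i : Fin n =>
      invQFact q (M i.castSucc - M i.succ - ascent (ε i.castSucc) (ε i.succ)))]
    refine Finset.prod_congr rfl fun i _ => ?_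
    simp only [reflection, Equiv.coe_fn_mk, Function.comp, Fin.revPerm_apply, Fin.rev_castSucc,
      Fin.rev_succ]
    congr 1
    cases ε i.rev.castSucc <;> cases ε i.rev.succ <;> simp [bit, ascent] <;> ring

/-- Reversal of `0`-`1` vectors. -/
def bitReverse (n : ℕ) : (Fin n → Bool) ≃ (Fin n → Bool) :=
  Equiv.arrowCongr Fin.revPerm (Equiv.refl _)

theorem bitReverse_apply {n : ℕ} (ε : Fin n → Bool) : bitReverse n ε = ε ∘ Fin.rev := rfl

theorem bitCount_comp_rev {n : ℕ} (ε : Fin n → Bool) : bitCount (ε ∘ Fin.rev) = bitCount ε :=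
  Equiv.sum_comp Fin.revPerm (fun i => bit (ε i))

/-- The sum of `lastTerm` over the hyperplane `∑ M_i = Y` is invariant under `Y ↦ -Y - ℓ`. -/
theorem tsum_lastTerm_neg {q : ℂ} (hq : ‖q‖ < 1) (hq0 : q ≠ 0) {n : ℕ}
    (hsum : ∀ ε : Fin (n + 1) → Bool, Summable (latticeTerm q ε)) (ℓ Y : ℤ) :
    (∑' M : Fin (n + 1) → ℤ, if ∑ i, M i = Y then lastTerm q ℓ M else 0) =
      ∑' M : Fin (n + 1) → ℤ, if ∑ i, M i = -Y - ℓ then lastTerm q ℓ M else 0 := by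
  have hS : ∀ (ε : Fin (n + 1) → Bool) (Z : ℤ), Summable fun M : Fin (n + 1) → ℤ =>
      if ∑ i, M i = Z then latticeTerm q ε M else 0 := fun ε Z =>
    ((hsum ε).indicator {M | ∑ i, M i = Z}).congr fun M => by
      simp [Set.indicator]
  have expand : ∀ Z : ℤ,
      (∑' M : Fin (n + 1) → ℤ, if ∑ i, M i = Z then lastTerm q ℓ M else 0) =
      ∑ ε : Fin (n + 1) → Bool, if bitCount ε = ℓ then
        ∑' M : Fin (n + 1) → ℤ, (if ∑ i, M i = Z then latticeTerm q ε M else 0) else 0 := by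
    intro Z
    have e : ∀ M : Fin (n + 1) → ℤ, (if ∑ i, M i = Z then lastTerm q ℓ M else 0) =
        ∑ ε : Fin (n + 1) → Bool, if bitCount ε = ℓ then
          (if ∑ i, M i = Z then latticeTerm q ε M else 0) else 0 := by
      intro M
      rw [← sum_latticeTerm hq hq0]
      split_ifs <;> simp
    rw [tsum_congr e, Summable.tsum_finsetSum]
    · refine Finset.sum_congr rfl fun ε _ => ?_
      split_ifs
      · rfl
      · simp
    · intro ε _
      split_ifs
      · exact hS ε Z
      · exact summable_zero
  rw [expand, expand, ← (bitReverse (n + 1)).sum_comp]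
  refine Finset.sum_congr rfl fun ε _ => ?_
  rw [bitReverse_apply, bitCount_comp_rev]
  split_ifs with h
  · rw [← (reflection ε).tsum_eq]
    refine tsum_congr fun M => ?_
    rw [sum_reflection, latticeTerm_reflection, h]
    exact if_congr (by constructor <;> intro h <;> linarith) rfl rfl
  · rfl

/-! ### Powers of `q` and convergence of Gaussian sums -/

theorem qpow_add (t : ℂ) (x y : ℚ) : qpow t (x + y) = qpow t x * qpow t y := by
  rw [qpow, qpow, qpow, ← Complex.exp_add]
  push_cast
  ring_nf

theorem qpow_zero (t : ℂ) : qpow t 0 = 1 := by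
  simp [qpow]

theorem qpow_intCast (t : ℂ) (m : ℤ) : qpow t m = Complex.exp t ^ m := by
  rw [qpow, ← Complex.exp_int_mul]
  simp

theorem qpow_ne_zero (t : ℂ) (x : ℚ) : qpow t x ≠ 0 := Complex.exp_ne_zero _

theorem qpow_sum {ι : Type*} (t : ℂ) (s : Finset ι) (f : ι → ℚ) :
    qpow t (∑ i ∈ s, f i) = ∏ i ∈ s, qpow t (f i) := by
  simp only [qpow]
  rw [← Complex.exp_sum, Rat.cast_sum, Finset.sum_mul]

theorem norm_qpow_le {t : ℂ} (ht : t.re < 0) {x y : ℚ} (h : x ≤ y) :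
    ‖qpow t y‖ ≤ ‖qpow t x‖ := by
  have e : ∀ z : ℚ, ((z : ℂ) * t).re = z * t.re := fun z => by
    simp
  rw [qpow, qpow, Complex.norm_exp, Complex.norm_exp, e, e, Real.exp_le_exp]
  have h' : (x : ℝ) ≤ y := by exact_mod_cast h
  nlinarith

theorem norm_exp_lt_one {t : ℂ} (ht : t.re < 0) : ‖Complex.exp t‖ < 1 := by
  rw [Complex.norm_exp]
  exact Real.exp_lt_one_iff.2 ht

/-- Gaussian sums over `ℤ` converge absolutely; they are two-variable theta series. -/
theorem summable_qpow_quadratic {t : ℂ} (ht : t.re < 0) {a : ℚ} (ha : 0 < a) (b c : ℚ) :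
    Summable fun j : ℤ => qpow t (a * (j : ℚ) ^ 2 + b * j + c) := by
  have hpi : (Real.pi : ℂ) ≠ 0 := by exact_mod_cast Real.pi_ne_zero
  have h := (summable_jacobiTheta₂_term_iff (b * t / (2 * Real.pi * Complex.I))
    (a * t / (Real.pi * Complex.I))).2 (by
      have e : (a : ℂ) * t / (Real.pi * Complex.I) =
          ((-(a : ℝ) / Real.pi : ℝ) : ℂ) * (t * Complex.I) := by
        push_cast
        field_simp
        rw [Complex.I_sq]
        ring
      rw [e, Complex.im_ofReal_mul]
      have ha' : (0 : ℝ) < a := by exact_mod_cast ha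
      have hre : (t * Complex.I).im = t.re := by simp
      rw [hre]
      have := Real.pi_pos
      have h1 : -(a : ℝ) / Real.pi < 0 := div_neg_of_neg_of_pos (by linarith) this
      exact mul_pos_of_neg_of_neg h1 ht)
  refine (h.mul_left (qpow t c)).congr fun j => ?_
  rw [jacobiTheta₂_term, qpow, qpow, ← Complex.exp_add]
  congr 1
  push_cast
  field_simp
  ring

theorem summable_pi_prod {ι : Type*} {n : ℕ} (f : Fin n → ι → ℝ) (h0 : ∀ i x, 0 ≤ f i x)
    (hf : ∀ i, Summable (f i)) : Summable fun M : Fin n → ι => ∏ i, f i (M i) := by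
  induction n with
  | zero => exact (hasSum_fintype _).summable
  | succ n ih =>
    rw [← (Fin.consEquiv fun _ => ι).summable_iff]
    have h := (hf 0).mul_of_nonneg (ih (fun i => f i.succ) (fun i => h0 i.succ) fun i => hf i.succ)
      (h0 0) fun M => Finset.prod_nonneg fun i _ => h0 _ _
    refine h.congr fun x => ?_
    simp [Fin.consEquiv, Fin.prod_univ_succ]

theorem exists_norm_invQFact_le {q : ℂ} (hq : ‖q‖ < 1) :
    ∃ c : ℝ, 1 ≤ c ∧ ∀ m, ‖invQFact q m‖ ≤ c := by
  obtain ⟨c, hc1, hc⟩ := exists_norm_inv_qFact_le hq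
  refine ⟨c, hc1, fun m => ?_⟩
  unfold invQFact
  split_ifs
  · rw [norm_zero]
    linarith
  · exact hc _

theorem summable_latticeTerm {t : ℂ} (ht : t.re < 0) {n : ℕ} (ε : Fin (n + 1) → Bool) :
    Summable (latticeTerm (Complex.exp t) ε) := by
  obtain ⟨c, hc1, hc⟩ := exists_norm_invQFact_le (norm_exp_lt_one ht)
  have h1 : Summable fun M : Fin (n + 1) → ℤ =>
      ∏ i, ‖qpow t (1 * (M i : ℚ) ^ 2 + (bit (ε i) : ℚ) * M i + 0)‖ :=
    summable_pi_prod (fun i (m : ℤ) => ‖qpow t (1 * (m : ℚ) ^ 2 + (bit (ε i) : ℚ) * m + 0)‖)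
      (fun _ _ => norm_nonneg _) fun i => (summable_qpow_quadratic ht one_pos _ _).norm
  refine Summable.of_norm_bounded (h1.mul_right (c ^ n)) fun M => ?_
  rw [latticeTerm, norm_mul, zpow_sum (Complex.exp_ne_zero t), norm_prod, norm_prod]
  refine mul_le_mul (Finset.prod_le_prod (fun _ _ => norm_nonneg _) fun i _ => le_of_eq ?_)
    ((Finset.prod_le_prod (fun _ _ => norm_nonneg _) fun i _ => hc _).trans (by simp))
    (Finset.prod_nonneg fun _ _ => norm_nonneg _) (Finset.prod_nonneg fun _ _ => norm_nonneg _)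
  rw [← qpow_intCast]
  push_cast
  ring_nf

/-! ### The inverse Cartan matrix in partition coordinates -/

theorem sum_by_parts {n : ℕ} (M : Fin (n + 1) → ℚ) (f : ℕ → ℚ) (h0 : f 0 = 0)
    (h1 : f (n + 1) = 0) :
    ∑ j : Fin n, f (j + 1) * (M j.castSucc - M j.succ) =
      ∑ j : Fin (n + 1), (f (j + 1) - f j) * M j := by
  have e1 := Fin.sum_univ_castSucc fun j : Fin (n + 1) => f (j + 1) * M j
  have e2 := Fin.sum_univ_succ fun j : Fin (n + 1) => f j * M j
  simp only [Fin.val_castSucc, Fin.val_last, Fin.val_succ, Fin.val_zero, h0, h1, zero_mul, add_zero,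
    zero_add] at e1 e2
  simp only [mul_sub, sub_mul, Finset.sum_sub_distrib]
  rw [e1, e2]

/-- The product `C⁻¹ v` for the type `A_n`, with the entries of `C⁻¹` written out. -/
noncomputable def cartanInvMul {n : ℕ} (v : Fin n → ℚ) (i : Fin n) : ℚ :=
  ∑ j : Fin n, (((min ((i : ℕ) + 1) ((j : ℕ) + 1) : ℕ) : ℚ) -
    ((i : ℕ) + 1) * ((j : ℕ) + 1) / ((n + 1 : ℕ) : ℚ)) * v j

theorem cartanInv_mulVec {n : ℕ} (v : Fin n → ℚ) (i : Fin n) :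
    (cartanInv (n + 1)).mulVec v i = cartanInvMul v i := by
  rw [Matrix.mulVec, dotProduct]
  exact Finset.sum_congr rfl fun j _ => congrArg (· * v j) (cartanInv_apply (n + 1) i j)

theorem cartanExponent_succ {n : ℕ} (ℓ : ℕ) (η : Fin n → ℕ) :
    cartanExponent (n + 1) ℓ η = ∑ i : Fin n, (η i : ℚ) *
      (cartanInvMul (fun j : Fin n => (η j : ℚ)) i -
        cartanInvMul (fun j : Fin n => if (j : ℕ) + 1 = ℓ then 1 else 0) i) := by
  rw [cartanExponent, Matrix.mulVec_sub]
  refine Finset.sum_congr rfl fun i _ => ?_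
  rw [← cartanInv_mulVec, ← cartanInv_mulVec]
  rfl

/-- If `n_i = M_i - M_{i+1}`, then `C⁻¹ n` has the entries `M_1 + ⋯ + M_i - (i / N) ∑ M_j`. -/
theorem cartanInvMul_sub {n : ℕ} (M : Fin (n + 1) → ℚ) (i : Fin n) :
    cartanInvMul (fun j : Fin n => M j.castSucc - M j.succ) i =
      (∑ j : Fin (n + 1), if (j : ℕ) < (i : ℕ) + 1 then M j else 0) -
        (((i : ℕ) + 1 : ℕ) : ℚ) / (n + 1) * ∑ j, M j := by
  have hn : ((n : ℚ) + 1) ≠ 0 := by positivity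
  have hi := i.isLt
  have h := sum_by_parts M
    (fun x => ((min ((i : ℕ) + 1) x : ℕ) : ℚ) - ((i : ℕ) + 1) * x / ((n + 1 : ℕ) : ℚ)) (by simp) (by
      rw [Nat.min_eq_left (by omega)]
      push_cast
      field_simp
      ring)
  unfold cartanInvMul
  push_cast at h ⊢
  rw [h, Finset.mul_sum, ← Finset.sum_sub_distrib]
  refine Finset.sum_congr rfl fun j _ => ?_
  split_ifs with hj
  · rw [min_eq_right (by exact_mod_cast hj), min_eq_right (by exact_mod_cast hj.le)]
    field_simp
    ring
  · rw [min_eq_left (by exact_mod_cast (by omega : (i : ℕ) + 1 ≤ j + 1)),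
      min_eq_left (by exact_mod_cast (by omega : (i : ℕ) + 1 ≤ j))]
    field_simp
    ring

theorem cartanInvMul_unitVec {n ℓ : ℕ} (hℓ : ℓ ≤ n + 1) (i : Fin n) :
    cartanInvMul (fun j : Fin n => if (j : ℕ) + 1 = ℓ then 1 else 0) i =
      ((min ((i : ℕ) + 1) ℓ : ℕ) : ℚ) - ((i : ℕ) + 1) * ℓ / (n + 1) := by
  have hi := i.isLt
  have hn : ((n : ℚ) + 1) ≠ 0 := by positivity
  unfold cartanInvMul
  simp only [mul_ite, mul_one, mul_zero]
  rcases Nat.eq_zero_or_pos ℓ with h0 | h0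
  · subst h0
    simp
  rcases hℓ.eq_or_lt with h1 | h1
  · subst h1
    rw [Finset.sum_eq_zero fun j _ => if_neg (by have := j.isLt; omega),
      Nat.min_eq_left (by omega)]
    push_cast
    field_simp
    ring
  · rw [Finset.sum_eq_single (⟨ℓ - 1, by omega⟩ : Fin n)]
    · rw [if_pos (by simp; omega)]
      have : ((ℓ - 1 : ℕ) : ℚ) + 1 = ℓ := by
        rw [Nat.cast_sub h0]
        simp
      rw [this, Nat.sub_add_cancel h0]
      push_cast
      ring
    · intro j _ hj
      rw [if_neg]
      intro h
      exact hj (Fin.ext (by simp; omega))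
    · simp

/-- The exponent `n C⁻¹ (n - e_ℓ)` in the coordinates `n_i = M_i - M_{i+1}`. -/
theorem cartanExponent_eq {n ℓ : ℕ} (hℓ : ℓ ≤ n + 1) (M : Fin (n + 1) → ℚ) (η : Fin n → ℕ)
    (hη : ∀ i, (η i : ℚ) = M i.castSucc - M i.succ) :
    cartanExponent (n + 1) ℓ η =
      (∑ j, M j ^ 2 + ∑ j : Fin (n + 1), if ℓ ≤ (j : ℕ) then M j else 0) -
        (∑ j, M j) * (∑ j, M j + (n + 1) - ℓ) / (n + 1) := by
  have hn : ((n : ℚ) + 1) ≠ 0 := by positivity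
  have hη' : (fun i => (η i : ℚ)) = fun i : Fin n => M i.castSucc - M i.succ := funext hη
  have a1 : ∑ i : Fin n, (η i : ℚ) * cartanInvMul (fun j : Fin n => (η j : ℚ)) i =
      ∑ j, M j ^ 2 - (∑ j, M j) ^ 2 / (n + 1) := by
    simp only [hη']
    have h := sum_by_parts M (fun x => (∑ j : Fin (n + 1), if (j : ℕ) < x then M j else 0) -
      (x : ℚ) / (n + 1) * ∑ j, M j) (by simp) (by
        rw [Finset.sum_congr rfl fun j _ => if_pos j.isLt]
        push_cast
        field_simp
        ring)
    simp only [hη, cartanInvMul_sub]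
    rw [Finset.sum_congr rfl fun j _ => mul_comm _ _, h, sq (∑ j, M j), mul_div_assoc,
      Finset.sum_mul, ← Finset.sum_sub_distrib]
    refine Finset.sum_congr rfl fun j _ => ?_
    have : (∑ k : Fin (n + 1), if (k : ℕ) < j + 1 then M k else 0) -
        (∑ k : Fin (n + 1), if (k : ℕ) < j then M k else 0) = M j := by
      rw [← Finset.sum_sub_distrib, Finset.sum_eq_single j]
      · simp
      · intro k _ hk
        have : (k : ℕ) ≠ j := fun h => hk (Fin.ext h)
        by_cases h : (k : ℕ) < j
        · rw [if_pos h, if_pos (by omega), sub_self]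
        · rw [if_neg h, if_neg (by omega), sub_self]
      · simp
    push_cast
    linear_combination M j * this
  have a2 : ∑ i : Fin n, (η i : ℚ) *
      cartanInvMul (fun j : Fin n => if (j : ℕ) + 1 = ℓ then 1 else 0) i =
      (∑ j : Fin (n + 1), if (j : ℕ) < ℓ then M j else 0) - ℓ / (n + 1) * ∑ j, M j := by
    have h := sum_by_parts M (fun x => ((min x ℓ : ℕ) : ℚ) - x * ℓ / (n + 1)) (by simp) (by
        rw [Nat.min_eq_right hℓ]
        push_cast
        field_simp
        ring)
    simp only [hη, cartanInvMul_unitVec hℓ]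
    push_cast at h ⊢
    rw [Finset.sum_congr rfl fun j _ => mul_comm _ _, h, Finset.mul_sum, ← Finset.sum_sub_distrib]
    refine Finset.sum_congr rfl fun j _ => ?_
    split_ifs with hj
    · rw [min_eq_left (by exact_mod_cast hj), min_eq_left (by exact_mod_cast hj.le)]
      ring
    · rw [min_eq_right (by exact_mod_cast (by omega : ℓ ≤ (j : ℕ) + 1)),
        min_eq_right (by exact_mod_cast (by omega : ℓ ≤ (j : ℕ)))]
      ring
  have a3 : (∑ j : Fin (n + 1), if (j : ℕ) < ℓ then M j else 0) +
      (∑ j : Fin (n + 1), if ℓ ≤ (j : ℕ) then M j else 0) = ∑ j, M j := by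
    rw [← Finset.sum_add_distrib]
    refine Finset.sum_congr rfl fun j _ => ?_
    by_cases h : (j : ℕ) < ℓ
    · simp [h, not_le.2 h]
    · simp [h, not_lt.1 h]
  simp only [cartanExponent_succ, mul_sub, Finset.sum_sub_distrib]
  rw [a1, a2]
  field_simp
  linear_combination (-((n : ℚ) + 1)) * a3

theorem cartanInvFirst_eq {n : ℕ} (M : Fin (n + 1) → ℚ) (η : Fin n → ℕ)
    (hη : ∀ i, (η i : ℚ) = M i.castSucc - M i.succ) :
    cartanInvFirst (n + 1) η = M 0 - (∑ j, M j) / (n + 1) := by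
  have hη' : (fun i => (η i : ℚ)) = fun i : Fin n => M i.castSucc - M i.succ := funext hη
  unfold cartanInvFirst
  split_ifs with h
  · refine (cartanInv_mulVec (fun i : Fin n => (η i : ℚ)) ⟨0, h⟩).trans ?_
    rw [hη', cartanInvMul_sub]
    rw [Finset.sum_eq_single (0 : Fin (n + 1))]
    · simp
      ring
    · intro j _ hj
      rw [if_neg]
      intro hj'
      exact hj (Fin.ext (by simp at hj' ⊢; omega))
    · simp
  · obtain rfl : n = 0 := by simpa using h
    simp

/-! ### Sums of parafermion terms as lattice sums -/

theorem eq_of_sub_eq_of_sum_eq {n : ℕ} {M M' : Fin (n + 1) → ℤ}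
    (h : ∀ i : Fin n, M i.castSucc - M i.succ = M' i.castSucc - M' i.succ)
    (hs : ∑ i, M i = ∑ i, M' i) : M = M' := by
  have hc : ∀ j, M j - M' j = M 0 - M' 0 := fun j => by
    induction j using Fin.induction with
    | zero => rfl
    | succ i ih =>
      have := h i
      omega
  have h1 : ∑ j, (M j - M' j) = (n + 1 : ℤ) * (M 0 - M' 0) := by
    rw [Finset.sum_congr rfl fun j _ => hc j]
    simp only [Finset.sum_const, Finset.card_univ, Fintype.card_fin, nsmul_eq_mul]
    push_cast
    rfl
  rw [Finset.sum_sub_distrib, hs, sub_self] at h1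
  have h2 : M 0 - M' 0 = 0 := by
    rcases mul_eq_zero.1 h1.symm with h | h
    · omega
    · exact h
  funext j
  have := hc j
  omega

/-- Every `n` of charge `u` comes from a vector `M` with `∑ M_i = u`. -/
theorem exists_partition_coord {n ℓ : ℕ} {m u : ℤ} (hu : m + ℓ = 2 * u) {η : Fin n → ℕ}
    (hη : η ∈ stringRange (n + 1) ℓ m) :
    ∃ M : Fin (n + 1) → ℤ, ∑ i, M i = u ∧ ∀ i, (η i : ℤ) = M i.castSucc - M i.succ := by
  obtain ⟨z, hz⟩ := hη
  have hn : ((n : ℚ) + 1) ≠ 0 := by positivity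
  -- The first entry of `M` has to be the integer `z` of the charge condition.
  let M : Fin (n + 1) → ℤ := fun j => z - ∑ i : Fin n, if (i : ℕ) < j then (η i : ℤ) else 0
  have hM : ∀ i, (η i : ℤ) = M i.castSucc - M i.succ := by
    intro i
    simp only [M, sub_sub_sub_cancel_left]
    rw [← Finset.sum_sub_distrib, Finset.sum_eq_single i]
    · simp
    · intro k _ hk
      have : (k : ℕ) ≠ i := fun h => hk (Fin.ext h)
      simp only [Fin.val_succ, Fin.val_castSucc]
      by_cases h : (k : ℕ) < i
      · rw [if_pos h, if_pos (by omega), sub_self]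
      · rw [if_neg h, if_neg (by omega), sub_self]
    · simp
  have h0 : M 0 = z := by simp [M]
  refine ⟨M, ?_, hM⟩
  have h1 := cartanInvFirst_eq (fun i => (M i : ℚ)) η fun i => by exact_mod_cast hM i
  rw [h1, h0] at hz
  have h2 : ((m : ℚ) + ℓ) = 2 * u := by exact_mod_cast hu
  rw [h2] at hz
  push_cast at hz
  have h3 : ((∑ i, M i : ℤ) : ℚ) = u := by
    push_cast
    field_simp at hz
    linarith
  exact_mod_cast h3

theorem lastTerm_eq {t : ℂ} {n ℓ : ℕ} (hℓ : ℓ ≤ n + 1) {M : Fin (n + 1) → ℤ} {η : Fin n → ℕ}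
    (hη : ∀ i, (η i : ℤ) = M i.castSucc - M i.succ) {u : ℤ} (hu : ∑ i, M i = u) :
    lastTerm (Complex.exp t) ((n + 1 : ℤ) - ℓ) M =
      qpow t ((u : ℚ) * (u + (n + 1) - ℓ) / (n + 1)) * parafermionTerm t (n + 1) ℓ η := by
  have h1 := cartanExponent_eq hℓ (fun i => (M i : ℚ)) η fun i => by exact_mod_cast hη i
  have hu' : ∑ i, (M i : ℚ) = u := by exact_mod_cast hu
  rw [hu'] at h1
  have h2 : ∏ i : Fin n, invQFact (Complex.exp t) (M i.castSucc - M i.succ) =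
      (∏ i : Fin n, qFact (Complex.exp t) (η i))⁻¹ := by
    rw [← Finset.prod_inv_distrib]
    refine Finset.prod_congr rfl fun i _ => ?_
    rw [← hη, invQFact_natCast]
  have h3 : lastProd ((n + 1 : ℤ) - ℓ) (fun i : Fin (n + 1) => Complex.exp t ^ M i) =
      Complex.exp t ^ (∑ j : Fin (n + 1), if ℓ ≤ (j : ℕ) then M j else 0) := by
    rw [lastProd, if_pos (by push_cast; omega), zpow_sum (Complex.exp_ne_zero t)]
    refine Finset.prod_congr rfl fun i _ => ?_
    by_cases h : ℓ ≤ (i : ℕ)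
    · rw [if_pos h, if_pos (by push_cast; omega)]
    · rw [if_neg h, if_neg (by push_cast; omega), zpow_zero]
  rw [lastTerm, h2, h3, parafermionTerm, h1, ← mul_div_assoc, ← qpow_add, div_eq_mul_inv,
    ← zpow_add₀ (Complex.exp_ne_zero t), ← qpow_intCast]
  have h4 : ((∑ i, M i ^ 2 + ∑ j : Fin (n + 1), (if ℓ ≤ (j : ℕ) then M j else 0) : ℤ) : ℚ) =
      ∑ j, (M j : ℚ) ^ 2 + ∑ j : Fin (n + 1), if ℓ ≤ (j : ℕ) then (M j : ℚ) else 0 := by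
    push_cast
    rfl
  rw [h4]
  congr 2
  ring

/-- The sum of parafermion terms over one charge sector is a lattice sum over a hyperplane. -/
theorem tsum_lastTerm_eq {t : ℂ} {n ℓ : ℕ} (hℓ : ℓ ≤ n + 1) {m u : ℤ} (hu : m + ℓ = 2 * u) :
    (∑' M : Fin (n + 1) → ℤ, if ∑ i, M i = u then
        lastTerm (Complex.exp t) ((n + 1 : ℤ) - ℓ) M else 0) =
      qpow t ((u : ℚ) * (u + (n + 1) - ℓ) / (n + 1)) *
        ∑' η : stringRange (n + 1) ℓ m, parafermionTerm t (n + 1) ℓ η := by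
  choose φ hφ1 hφ2 using fun η : stringRange (n + 1) ℓ m => exists_partition_coord hu η.2
  have inj : Function.Injective φ := fun η η' h => by
    apply Subtype.ext
    funext i
    have h1 := hφ2 η i
    have h2 := hφ2 η' i
    rw [h, ← h2] at h1
    exact_mod_cast h1
  rw [← inj.tsum_eq, ← tsum_mul_left]
  · refine tsum_congr fun η => ?_
    rw [if_pos (hφ1 η), lastTerm_eq hℓ (hφ2 η) (hφ1 η)]
  · intro M hM
    have hsum : ∑ i, M i = u := by
      by_contra h
      exact hM (if_neg h)
    have hne : lastTerm (Complex.exp t) ((n + 1 : ℤ) - ℓ) M ≠ 0 := by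
      intro h
      exact hM (by simp [h])
    -- `1 / (q)_k` vanishes for `k < 0`, so `M` is weakly decreasing.
    have hanti : ∀ i : Fin n, 0 ≤ M i.castSucc - M i.succ := by
      intro i
      by_contra h
      refine hne ?_
      rw [lastTerm, Finset.prod_eq_zero (Finset.mem_univ i), mul_zero]
      exact if_pos (not_le.1 h)
    let η : Fin n → ℕ := fun i => (M i.castSucc - M i.succ).toNat
    have hη : ∀ i, (η i : ℤ) = M i.castSucc - M i.succ := fun i => Int.toNat_of_nonneg (hanti i)
    have hmem : η ∈ stringRange (n + 1) ℓ m := by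
      refine ⟨M 0, ?_⟩
      rw [cartanInvFirst_eq (fun i => (M i : ℚ)) η fun i => by exact_mod_cast hη i]
      have h2 : ((m : ℚ) + ℓ) = 2 * u := by exact_mod_cast hu
      have h3 : ∑ i, (M i : ℚ) = u := by exact_mod_cast hsum
      have hn : ((n : ℚ) + 1) ≠ 0 := by positivity
      rw [h2, h3]
      push_cast
      field_simp
      ring
    refine ⟨⟨η, hmem⟩, ?_⟩
    refine eq_of_sub_eq_of_sum_eq (fun i => ?_) ((hφ1 _).trans hsum.symm)
    rw [← hφ2, ← hη]

/-- The sum of `q ^ {n C⁻¹ (n - e_ℓ)} / (q)_n` over the sector of charge `m`; up to a prefactor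
this is the string function `c^ℓ_m`. -/
noncomputable def parafermionSum (t : ℂ) (N ℓ : ℕ) (m : ℤ) : ℂ :=
  ∑' η : stringRange N ℓ m, parafermionTerm t N ℓ η

theorem stringRange_congr {N : ℕ} (hN : 1 ≤ N) (ℓ : ℕ) {m m' : ℤ} (h : (2 * N : ℤ) ∣ m - m') :
    stringRange N ℓ m = stringRange N ℓ m' := by
  have hN' : (N : ℚ) ≠ 0 := by positivity
  obtain ⟨c, hc⟩ := h
  have hc' : (m : ℚ) - m' = 2 * N * c := by exact_mod_cast hc
  have hm : (m : ℚ) = m' + 2 * N * c := by linarith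
  ext η
  constructor
  · rintro ⟨z, hz⟩
    refine ⟨z - c, ?_⟩
    push_cast
    rw [← hz, hm]
    field_simp
    ring
  · rintro ⟨z, hz⟩
    refine ⟨z + c, ?_⟩
    push_cast
    rw [← hz, hm]
    field_simp
    ring

theorem parafermionSum_congr {N : ℕ} (hN : 1 ≤ N) (t : ℂ) (ℓ : ℕ) {m m' : ℤ}
    (h : (2 * N : ℤ) ∣ m - m') : parafermionSum t N ℓ m = parafermionSum t N ℓ m' := by
  unfold parafermionSum
  rw [stringRange_congr hN ℓ h]

/-- The Weyl symmetry `c^ℓ_m = c^ℓ_{-m}` of the string functions. -/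
theorem parafermionSum_neg {t : ℂ} (ht : t.re < 0) {N ℓ : ℕ} (hN : 1 ≤ N) (hℓ : ℓ ≤ N) {m : ℤ}
    (hm : (2 : ℤ) ∣ m + ℓ) : parafermionSum t N ℓ (-m) = parafermionSum t N ℓ m := by
  obtain ⟨n, rfl⟩ := Nat.exists_eq_add_of_le' hN
  obtain ⟨u, hu⟩ := hm
  have h1 := tsum_lastTerm_eq (t := t) hℓ hu
  -- The reflected sum `-u - (N - ℓ)` belongs to the charge `-m - 2 N`.
  have h2 := tsum_lastTerm_eq (t := t) (m := -m - 2 * (n + 1)) (u := -u - ((n + 1 : ℤ) - ℓ)) hℓ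
    (by linarith)
  rw [tsum_lastTerm_neg (norm_exp_lt_one ht) (Complex.exp_ne_zero t)
    (fun ε => summable_latticeTerm ht ε) _ u, h2] at h1
  have e : ((-u - ((n + 1 : ℤ) - ℓ) : ℤ) : ℚ) *
      (((-u - ((n + 1 : ℤ) - ℓ) : ℤ) : ℚ) + (n + 1) - ℓ) / (n + 1) =
      (u : ℚ) * (u + (n + 1) - ℓ) / (n + 1) := by
    push_cast
    ring
  rw [e] at h1
  rw [parafermionSum_congr hN t ℓ (m' := -m - 2 * (n + 1)) ⟨1, by push_cast; ring⟩]
  exact mul_left_cancel₀ (qpow_ne_zero _ _) h1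

/-- The diagonal of the quadratic form `n C⁻¹ n` dominates, since all entries of `C⁻¹` are
non-negative. -/
theorem le_cartanExponent {n ℓ : ℕ} (hℓ : ℓ ≤ n + 1) (η : Fin n → ℕ) :
    ∑ i, (1 / 2 * (η i : ℚ) ^ 2 + (-(n + 1)) * η i + 0) ≤ cartanExponent (n + 1) ℓ η := by
  have hn : (0 : ℚ) < (n : ℚ) + 1 := by positivity
  rw [cartanExponent_succ]
  refine Finset.sum_le_sum fun i _ => ?_
  have hi := i.isLt
  have hη : (0 : ℚ) ≤ η i := Nat.cast_nonneg _
  have entry : ∀ j : Fin n, (0 : ℚ) ≤ ((min ((i : ℕ) + 1) ((j : ℕ) + 1) : ℕ) : ℚ) -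
      ((i : ℕ) + 1) * ((j : ℕ) + 1) / ((n + 1 : ℕ) : ℚ) := by
    intro j
    have hj : ((j : ℕ) : ℚ) + 1 ≤ n + 1 := by exact_mod_cast (by omega : (j : ℕ) + 1 ≤ n + 1)
    have hi' : ((i : ℕ) : ℚ) + 1 ≤ n + 1 := by exact_mod_cast (by omega : (i : ℕ) + 1 ≤ n + 1)
    have hi0 : (0 : ℚ) ≤ ((i : ℕ) : ℚ) := Nat.cast_nonneg _
    have hj0 : (0 : ℚ) ≤ ((j : ℕ) : ℚ) := Nat.cast_nonneg _
    rw [sub_nonneg]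
    push_cast
    rw [div_le_iff₀ hn]
    rcases min_cases (((i : ℕ) : ℚ) + 1) (((j : ℕ) : ℚ) + 1) with ⟨h, _⟩ | ⟨h, _⟩ <;> rw [h] <;>
      nlinarith
  have diag : (1 / 2 : ℚ) ≤ ((min ((i : ℕ) + 1) ((i : ℕ) + 1) : ℕ) : ℚ) -
      ((i : ℕ) + 1) * ((i : ℕ) + 1) / ((n + 1 : ℕ) : ℚ) := by
    have hi' : ((i : ℕ) : ℚ) + 1 ≤ n := by exact_mod_cast (by omega : (i : ℕ) + 1 ≤ n)
    have hi0 : (0 : ℚ) ≤ ((i : ℕ) : ℚ) := Nat.cast_nonneg _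
    rw [le_sub_iff_add_le, ← le_sub_iff_add_le']
    push_cast
    rw [min_self, div_le_iff₀ hn]
    nlinarith
  have quad : 1 / 2 * (η i : ℚ) ≤ cartanInvMul (fun j : Fin n => (η j : ℚ)) i := by
    unfold cartanInvMul
    refine le_trans ?_ (Finset.single_le_sum (fun j _ => mul_nonneg (entry j) (Nat.cast_nonneg _))
      (Finset.mem_univ i))
    exact mul_le_mul_of_nonneg_right diag hη
  have lin : cartanInvMul (fun j : Fin n => if (j : ℕ) + 1 = ℓ then 1 else 0) i ≤ n + 1 := by
    rw [cartanInvMul_unitVec hℓ]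
    have h1 : ((min ((i : ℕ) + 1) ℓ : ℕ) : ℚ) ≤ n + 1 := by
      exact_mod_cast (by omega : min ((i : ℕ) + 1) ℓ ≤ n + 1)
    have h2 : (0 : ℚ) ≤ ((i : ℕ) + 1) * ℓ / (n + 1) := by positivity
    linarith
  have := mul_le_mul_of_nonneg_left (sub_le_sub quad lin) hη
  linarith

theorem summable_parafermionTerm {t : ℂ} (ht : t.re < 0) {N ℓ : ℕ} (hN : 1 ≤ N) (hℓ : ℓ ≤ N) :
    Summable (parafermionTerm t N ℓ) := by
  obtain ⟨n, rfl⟩ := Nat.exists_eq_add_of_le' hN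
  obtain ⟨c, hc1, hc⟩ := exists_norm_inv_qFact_le (norm_exp_lt_one ht)
  have h1 : Summable fun η : Fin n → ℕ =>
      ∏ i, ‖qpow t (1 / 2 * (η i : ℚ) ^ 2 + (-(n + 1)) * η i + 0)‖ :=
    summable_pi_prod (fun _ (m : ℕ) => ‖qpow t (1 / 2 * (m : ℚ) ^ 2 + (-(n + 1)) * m + 0)‖)
      (fun _ _ => norm_nonneg _) fun i =>
        (summable_qpow_quadratic ht (by norm_num) _ _).norm.comp_injective
          (i := fun m : ℕ => (m : ℤ)) Nat.cast_injective
  refine Summable.of_norm_bounded (h1.mul_right (c ^ n)) fun η => ?_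
  rw [parafermionTerm, div_eq_mul_inv, norm_mul, ← Finset.prod_inv_distrib, ← norm_prod,
    ← qpow_sum]
  refine mul_le_mul (norm_qpow_le ht (le_cartanExponent hℓ η)) ?_ (norm_nonneg _) (norm_nonneg _)
  rw [norm_prod]
  exact (Finset.prod_le_prod (fun _ _ => norm_nonneg _) fun i _ => hc _).trans (by simp)

/-! ### Branching functions as sums over all integers -/

theorem summable_thetaTermFirst {t : ℂ} (ht : t.re < 0) {P P' : ℤ} (hP : 0 < P * P') {N : ℕ}
    (hN : 1 ≤ N) (r s : ℤ) : Summable (thetaTermFirst t P P' N r s) := by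
  have hN' : (0 : ℚ) < N := by exact_mod_cast hN
  have hP' : (0 : ℚ) < P * P' := by exact_mod_cast hP
  refine (summable_qpow_quadratic ht (a := P * P' / N) (by positivity)
    ((P' * r - P * s) / N) 0).congr fun j => ?_
  rw [thetaTermFirst]
  congr 1
  field_simp
  ring

theorem summable_thetaTermSecond {t : ℂ} (ht : t.re < 0) {P P' : ℤ} (hP : 0 < P * P') {N : ℕ}
    (hN : 1 ≤ N) (r s : ℤ) : Summable (thetaTermSecond t P P' N r s) := by
  have hN' : (0 : ℚ) < N := by exact_mod_cast hN
  have hP' : (0 : ℚ) < P * P' := by exact_mod_cast hP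
  refine (summable_qpow_quadratic ht (a := P * P' / N) (by positivity)
    ((P' * r + P * s) / N) (r * s / N)).congr fun j => ?_
  rw [thetaTermSecond]
  congr 1
  field_simp
  ring

theorem branchingConverges {t : ℂ} (ht : t.re < 0) {P P' : ℤ} (hP : 0 < P * P') {N ℓ : ℕ}
    (hN : 1 ≤ N) (hℓ : ℓ ≤ N) (r s : ℤ) : BranchingConverges t P P' N r s ℓ :=
  ⟨fun _ => (summable_parafermionTerm ht hN hℓ).subtype _,
    fun _ => (summable_thetaTermFirst ht hP hN r s).subtype _,
    fun _ => (summable_thetaTermSecond ht hP hN r s).subtype _⟩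

theorem exists_norm_parafermionSum_le {t : ℂ} (ht : t.re < 0) {N ℓ : ℕ} (hN : 1 ≤ N)
    (hℓ : ℓ ≤ N) : ∃ c : ℝ, ∀ m, ‖parafermionSum t N ℓ m‖ ≤ c := by
  have h := (summable_parafermionTerm ht hN hℓ).norm
  refine ⟨∑' η, ‖parafermionTerm t N ℓ η‖, fun m => ?_⟩
  exact (norm_tsum_le_tsum_norm (h.subtype _)).trans
    (h.tsum_subtype_le _ (stringRange N ℓ m) fun _ => norm_nonneg _)

theorem summable_mul_parafermionSum {t : ℂ} (ht : t.re < 0) {N ℓ : ℕ} (hN : 1 ≤ N)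
    (hℓ : ℓ ≤ N) {f : ℤ → ℂ} (hf : Summable f) (c : ℤ → ℤ) :
    Summable fun j => f j * parafermionSum t N ℓ (c j) := by
  obtain ⟨C, hC⟩ := exists_norm_parafermionSum_le ht hN hℓ
  refine Summable.of_norm_bounded (hf.norm.mul_right C) fun j => ?_
  rw [norm_mul]
  exact mul_le_mul_of_nonneg_left (hC _) (norm_nonneg _)

/-- Parafermion sums depend on the charge only up to sign and modulo `2 N`. -/
theorem parafermionSum_eq {t : ℂ} (ht : t.re < 0) {N ℓ : ℕ} (hN : 1 ≤ N) (hℓ : ℓ ≤ N) {x y : ℤ}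
    (hy : (2 : ℤ) ∣ y + ℓ) (h : (2 * N : ℤ) ∣ x - y ∨ (2 * N : ℤ) ∣ x + y) :
    parafermionSum t N ℓ x = parafermionSum t N ℓ y := by
  rcases h with h | h
  · exact parafermionSum_congr hN t ℓ h
  · rw [← parafermionSum_neg ht hN hℓ hy]
    exact parafermionSum_congr hN t ℓ (by rwa [sub_neg_eq_add])

/-- Every integer is congruent to `± M` modulo `2 N` for exactly one `M` with `0 ≤ M ≤ N`. -/
theorem existsUnique_dvd_sub_or_add {N : ℕ} (hN : 1 ≤ N) (c : ℤ) :
    ∃ M : ℕ, M ≤ N ∧ ∀ M' : ℕ, M' ≤ N →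
      (((2 * N : ℤ) ∣ c - M' ∨ (2 * N : ℤ) ∣ c + M') ↔ M' = M) := by
  have hN' : (0 : ℤ) < 2 * N := by positivity
  have h0 := Int.emod_nonneg c hN'.ne'
  have h1 := Int.emod_lt_of_pos c hN'
  have h2 := Int.mul_ediv_add_emod c (2 * N)
  generalize c % (2 * N : ℤ) = r at h0 h1 h2
  generalize c / (2 * N : ℤ) = k at h2
  have aux : ∀ x : ℤ, (2 * N : ℤ) ∣ c + x ↔ (2 * N : ℤ) ∣ r + x := fun x => by
    rw [← h2, add_assoc]
    exact (Int.dvd_add_right (Dvd.intro _ rfl))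
  have small : ∀ x : ℤ, (2 * N : ℤ) ∣ x → -(2 * N) < x → x < 4 * N → x = 0 ∨ x = 2 * N := by
    rintro x ⟨e, rfl⟩ hl hu
    have e1 : -1 < e := by nlinarith
    have e2 : e < 2 := by nlinarith
    obtain rfl | rfl : e = 0 ∨ e = 1 := by omega
    · left; ring
    · right; ring
  -- With `r = c mod 2 N` the representative is `r` or `2 N - r`, whichever is smaller.
  refine ⟨(min r (2 * N - r)).toNat, by omega, fun M' hM' => ?_⟩
  rw [sub_eq_add_neg, aux, aux]
  constructor
  · rintro (h | h)
    · rcases small _ h (by omega) (by omega) with h | h <;> omega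
    · rcases small _ h (by omega) (by omega) with h | h <;> omega
  · intro h
    rcases le_total r (2 * N - r) with hr | hr
    · left
      rw [show r + -(M' : ℤ) = 0 by omega]
      exact dvd_zero _
    · right
      rw [show r + (M' : ℤ) = 2 * N by omega]

theorem sum_parafermionSum_mul_tsum {t : ℂ} (ht : t.re < 0) {N ℓ : ℕ} (hN : 1 ≤ N) (hℓ : ℓ ≤ N)
    {f : ℤ → ℂ} (hf : Summable f) (P' : ℤ) {a : ℤ} (ha : (2 : ℤ) ∣ a + ℓ) :
    ∑ M ∈ Finset.range (N + 1) with M % 2 = ℓ % 2,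
        parafermionSum t N ℓ M * ∑' j : thetaRange P' N a M, f j =
      ∑' j, f j * parafermionSum t N ℓ (a + 2 * P' * j) := by
  have e : ∀ M : ℕ, parafermionSum t N ℓ M * ∑' j : thetaRange P' N a M, f j =
      ∑' j, parafermionSum t N ℓ M * (thetaRange P' N a M).indicator f j := fun M => by
    rw [tsum_subtype, tsum_mul_left]
  rw [Finset.sum_congr rfl fun M _ => e M, ← Summable.tsum_finsetSum fun M _ =>
    (hf.indicator _).mul_left _]
  refine tsum_congr fun j => ?_
  obtain ⟨M, hM, huniq⟩ := existsUnique_dvd_sub_or_add hN (a + 2 * P' * j)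
  have hmem := (huniq M hM).2 rfl
  have hpar : (2 : ℤ) ∣ (M : ℤ) + ℓ := by
    have hc : (2 : ℤ) ∣ a + 2 * P' * j + ℓ := by
      have : (2 : ℤ) ∣ 2 * P' * j := ⟨P' * j, by ring⟩
      omega
    rcases hmem with ⟨k, hk⟩ | ⟨k, hk⟩
    · rw [show (2 * N : ℤ) * k = 2 * (N * k) by ring] at hk
      omega
    · rw [show (2 * N : ℤ) * k = 2 * (N * k) by ring] at hk
      omega
  rw [Finset.sum_eq_single M]
  · rw [Set.indicator_of_mem (show j ∈ thetaRange P' N a M from hmem), mul_comm,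
      parafermionSum_eq ht hN hℓ hpar hmem]
  · intro M' hM' hne
    rw [Set.indicator_of_notMem, mul_zero]
    intro h
    simp only [Finset.mem_filter, Finset.mem_range] at hM'
    exact hne ((huniq M' (by omega)).1 h)
  · intro h
    exact absurd (Finset.mem_filter.2 ⟨Finset.mem_range.2 (by omega), by omega⟩) h

/-- The symmetry of the string functions merges the sectors of the branching function. -/
theorem branching_eq {t : ℂ} (ht : t.re < 0) {P P' : ℤ} (hP : 0 < P * P') {N ℓ : ℕ}
    (hN : 1 ≤ N) (hℓ : ℓ ≤ N) {r s : ℤ} (hpar : (2 : ℤ) ∣ r - s + ℓ) :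
    branching t P P' N r s ℓ = 1 / qFactInf (Complex.exp t) *
      ((∑' j, thetaTermFirst t P P' N r s j * parafermionSum t N ℓ (r - s + 2 * P' * j)) -
        ∑' j, thetaTermSecond t P P' N r s j * parafermionSum t N ℓ (r + s + 2 * P' * j)) := by
  rw [← sum_parafermionSum_mul_tsum ht hN hℓ (summable_thetaTermFirst ht hP hN r s) P' hpar,
    ← sum_parafermionSum_mul_tsum ht hN hℓ (summable_thetaTermSecond ht hP hN r s) P'
      (show (2 : ℤ) ∣ r + s + ℓ by omega), ← Finset.sum_sub_distrib, branching, Finset.mul_sum,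
    Finset.mul_sum]
  refine Finset.sum_congr rfl fun M _ => ?_
  have h := qpow_add t (-((ℓ : ℚ) * (N - ℓ) / (2 * N * (N + 2))))
    ((ℓ : ℚ) * (N - ℓ) / (2 * N * (N + 2)))
  rw [neg_add_cancel, qpow_zero] at h
  rw [stringFunction, ← parafermionSum]
  linear_combination (-(1 / qFactInf (Complex.exp t) * parafermionSum t N ℓ M *
    ((∑' j : thetaRange P' N (r - s) M, thetaTermFirst t P P' N r s j) -
      ∑' j : thetaRange P' N (r + s) M, thetaTermSecond t P P' N r s j))) * h

/-! ### The limit of the Forrester–Baxter polynomials -/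

theorem parafermionSum_one (t : ℂ) {ℓ : ℕ} {m : ℤ} (h : (2 : ℤ) ∣ m + ℓ) :
    parafermionSum t 1 ℓ m = 1 := by
  obtain ⟨u, hu⟩ := h
  have hmem : ∀ η, η ∈ stringRange 1 ℓ m := fun η => ⟨u, by
    have : (m : ℚ) + ℓ = 2 * u := by exact_mod_cast hu
    rw [this]
    simp [cartanInvFirst]⟩
  have huniv : stringRange 1 ℓ m = Set.univ := Set.eq_univ_of_forall hmem
  have h1 : ∀ η : Fin (1 - 1) → ℕ, parafermionTerm t 1 ℓ η = 1 := fun η => by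
    have h0 : cartanExponent 1 ℓ η = 0 := (cartanExponent_succ (n := 0) ℓ η).trans (by simp)
    have h2 : ∏ i, qFact (Complex.exp t) (η i) = 1 := Finset.prod_of_isEmpty (ι := Fin 0) _
    rw [parafermionTerm, h0, h2, qpow_zero, div_one]
  rw [parafermionSum, huniv, tsum_univ (parafermionTerm t 1 ℓ), tsum_congr h1]
  have : Unique (Fin (1 - 1) → ℕ) := inferInstanceAs (Unique (Fin 0 → ℕ))
  rw [tsum_fintype]
  simp

theorem tendsto_centralBinom {q : ℂ} (hq : ‖q‖ < 1) (lam i : ℕ) :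
    Filter.Tendsto (fun L => centralBinom q lam L i) Filter.atTop (nhds (1 / qFactInf q)) := by
  have h := tendsto_qFact hq
  have h0 := qFactInf_ne_zero hq
  have a1 : Filter.Tendsto (fun L => 2 * L + lam) Filter.atTop Filter.atTop :=
    Filter.tendsto_atTop_mono (fun L => (by omega : L ≤ _)) Filter.tendsto_id
  have a2 : Filter.Tendsto (fun L => L - i) Filter.atTop Filter.atTop :=
    Filter.tendsto_sub_atTop_nat i
  have a3 : Filter.Tendsto (fun L => L + i + lam) Filter.atTop Filter.atTop :=
    Filter.tendsto_atTop_mono (fun L => (by omega : L ≤ _)) Filter.tendsto_id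
  have key := (h.comp a1).div ((h.comp a2).mul (h.comp a3)) (mul_ne_zero h0 h0)
  have e : qFactInf q / (qFactInf q * qFactInf q) = 1 / qFactInf q := by
    field_simp
  rw [e] at key
  refine key.congr' ?_
  filter_upwards [Filter.eventually_ge_atTop i] with L hL
  simp [centralBinom, hL]

theorem exists_norm_centralBinom_le {q : ℂ} (hq : ‖q‖ < 1) (lam : ℕ) :
    ∃ c : ℝ, ∀ L i, ‖centralBinom q lam L i‖ ≤ c := by
  obtain ⟨c, hc1, hc⟩ := exists_norm_qFact_le hq
  obtain ⟨d, hd1, hd⟩ := exists_norm_inv_qFact_le hq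
  refine ⟨c * (d * d), fun L i => ?_⟩
  unfold centralBinom
  split_ifs
  · rw [div_eq_mul_inv, mul_inv, norm_mul, norm_mul]
    exact mul_le_mul (hc _) (mul_le_mul (hd _) (hd _) (norm_nonneg _) (by linarith))
      (mul_nonneg (norm_nonneg _) (norm_nonneg _)) (by linarith)
  · rw [norm_zero]
    positivity

theorem summable_posExp {t : ℂ} (ht : t.re < 0) {p' P : ℤ} (hP : 0 < P * p') (s R : ℤ) :
    Summable fun j => Complex.exp t ^ posExp p' s P R j := by
  refine (summable_thetaTermFirst ht hP le_rfl R s).congr fun j => ?_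
  rw [thetaTermFirst, ← qpow_intCast, posExp]
  congr 1
  push_cast
  ring

theorem summable_negExp {t : ℂ} (ht : t.re < 0) {p' P : ℤ} (hP : 0 < P * p') (s R : ℤ) :
    Summable fun j => Complex.exp t ^ negExp p' s P R j := by
  refine (summable_thetaTermSecond ht hP le_rfl R s).congr fun j => ?_
  rw [thetaTermSecond, ← qpow_intCast, negExp]
  congr 1
  push_cast
  ring

theorem tendsto_bosonicB {t : ℂ} (ht : t.re < 0) {p p' r s b : ℤ} (hp : 0 < p)
    (hs : 1 ≤ s ∧ s ≤ p' - 1) (hb : 1 ≤ b ∧ b ≤ p' - 1) {ℓ : ℕ} (hℓ : ℓ ≤ 1)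
    (hpar : Even (r - s + ℓ)) :
    Filter.Tendsto (fun L : ℕ => bosonicB (Complex.exp t) p p' r s (2 * L + (b - s).natAbs) b)
      Filter.atTop (nhds (branching t p p' 1 r s ℓ)) := by
  have hP : 0 < p * p' := mul_pos hp (by omega)
  have hq := norm_exp_lt_one ht
  have hpar' : (2 : ℤ) ∣ r - s + ℓ := hpar.two_dvd
  have s1 := summable_posExp ht hP s r
  have s2 := summable_negExp ht hP s r
  obtain ⟨C, hC⟩ := exists_norm_centralBinom_le hq (b - s).natAbs
  have hlim : branching t p p' 1 r s ℓ = ∑' j,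
      (Complex.exp t ^ posExp p' s p r j * (1 / qFactInf (Complex.exp t)) -
        Complex.exp t ^ negExp p' s p r j * (1 / qFactInf (Complex.exp t))) := by
    rw [branching_eq ht hP le_rfl hℓ hpar', (s1.mul_right _).tsum_sub (s2.mul_right _),
      tsum_mul_right, tsum_mul_right, ← sub_mul, mul_comm (1 / qFactInf (Complex.exp t))]
    congr 2 <;> refine tsum_congr fun j => ?_
    · have : (2 : ℤ) ∣ 2 * p' * j := ⟨p' * j, by ring⟩
      rw [parafermionSum_one t (by omega), mul_one, thetaTermFirst, ← qpow_intCast, posExp]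
      congr 1
      push_cast
      ring
    · have : (2 : ℤ) ∣ 2 * p' * j := ⟨p' * j, by ring⟩
      rw [parafermionSum_one t (by omega), mul_one, thetaTermSecond, ← qpow_intCast, negExp]
      congr 1
      push_cast
      ring
  rw [hlim]
  simp only [bosonicB_eq_tsum hs hb]
  refine tendsto_tsum_of_dominated_convergence
    (bound := fun j => ‖Complex.exp t ^ posExp p' s p r j‖ * C +
      ‖Complex.exp t ^ negExp p' s p r j‖ * C)
    ((s1.norm.mul_right C).add (s2.norm.mul_right C)) (fun j => ?_)
    (Filter.Eventually.of_forall fun L j => ?_)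
  · exact ((tendsto_centralBinom hq _ _).const_mul _).sub
      ((tendsto_centralBinom hq _ _).const_mul _)
  · refine (norm_sub_le _ _).trans (add_le_add ?_ ?_) <;> rw [norm_mul] <;>
      exact mul_le_mul_of_nonneg_left (hC _ _) (norm_nonneg _)

/-! ### The higher-level Bailey flow -/

theorem etaRange_eq {N : ℕ} (hN : 1 ≤ N) (lam ℓ σ L : ℕ) :
    etaRange N lam ℓ σ L = stringRange N ℓ (N * σ - (2 * L + lam)) := by
  have hN' : (N : ℚ) ≠ 0 := by positivity
  ext η
  constructor
  · rintro ⟨z, hz⟩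
    refine ⟨-z, ?_⟩
    have h : cartanInvFirst N η = ((L : ℚ) + ((lam : ℚ) - ℓ) / 2) / N - (z + (σ : ℚ) / 2) := by
      linarith
    rw [h]
    push_cast
    field_simp
    ring
  · rintro ⟨z, hz⟩
    refine ⟨-z, ?_⟩
    have h : cartanInvFirst N η = z - (((N * σ - (2 * L + lam) : ℤ) : ℚ) + ℓ) / (2 * N) := by
      linarith
    rw [h]
    push_cast
    field_simp
    ring

section

variable {p' b s : ℤ}

theorem posTerm_eq (hs : 1 ≤ s ∧ s ≤ p' - 1) (hb : 1 ≤ b ∧ b ≤ p' - 1) (t : ℂ) {N : ℕ}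
    (hN : 1 ≤ N) (P R j : ℤ) :
    Complex.exp t ^ posExp p' s P R j *
        qpow t ((posIndex p' b s j : ℚ) * (posIndex p' b s j + (b - s).natAbs) / N) =
      thetaTermFirst t p' (p' + N * P) N s (b + N * R) (-j) := by
  have hN' : (N : ℚ) ≠ 0 := by positivity
  have h : (posIndex p' b s j : ℚ) * (posIndex p' b s j + (b - s).natAbs) = posExp p' s p' b j := by
    rw [← posIndex_mul_add hs hb j, Int.cast_natCast, Nat.cast_mul, Nat.cast_add]
  rw [h, ← qpow_intCast, ← qpow_add, thetaTermFirst, posExp, posExp]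
  congr 1
  push_cast
  field_simp
  ring

theorem negTerm_eq (hs : 1 ≤ s ∧ s ≤ p' - 1) (hb : 1 ≤ b ∧ b ≤ p' - 1) (t : ℂ) {N : ℕ}
    (hN : 1 ≤ N) (P R j : ℤ) :
    Complex.exp t ^ negExp p' s P R j *
        qpow t ((negIndex p' b s j : ℚ) * (negIndex p' b s j + (b - s).natAbs) / N) =
      thetaTermSecond t p' (p' + N * P) N s (b + N * R) j := by
  have hN' : (N : ℚ) ≠ 0 := by positivity
  have h : (negIndex p' b s j : ℚ) * (negIndex p' b s j + (b - s).natAbs) = negExp p' s p' b j := by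
    rw [← negIndex_mul_add hs hb j, Int.cast_natCast, Nat.cast_mul, Nat.cast_add]
  rw [h, ← qpow_intCast, ← qpow_add, thetaTermSecond, negExp, negExp]
  congr 1
  push_cast
  field_simp
  ring

/-- The charge sector picked out by the reflection position `d` is that of `± (d + N R)`. -/
theorem parafermionSum_sub_abs {t : ℂ} (ht : t.re < 0) {N ℓ σ : ℕ} (hN : 1 ≤ N) (hℓ : ℓ ≤ N)
    {R d c : ℤ} (hσ : (σ : ℤ) ≡ R [ZMOD 2]) (hc : (2 : ℤ) ∣ c + ℓ)
    (h : (2 * N : ℤ) ∣ c - (d + N * R) ∨ (2 * N : ℤ) ∣ c + (d + N * R)) :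
    parafermionSum t N ℓ (N * σ - |d|) = parafermionSum t N ℓ c := by
  obtain ⟨e, he⟩ := hσ.dvd
  have hR : R = σ + 2 * e := by linarith
  subst hR
  refine parafermionSum_eq ht hN hℓ hc ?_
  rcases abs_cases d with ⟨hd, _⟩ | ⟨hd, _⟩ <;> rw [hd] <;> rcases h with ⟨k, hk⟩ | ⟨k, hk⟩
  · exact Or.inr ⟨k + σ + e, by linear_combination hk⟩
  · exact Or.inl ⟨-k + σ + e, by linear_combination -hk⟩
  · exact Or.inl ⟨-k - e, by linear_combination -hk⟩
  · exact Or.inr ⟨k - e, by linear_combination hk⟩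

/-- Both flows are instances: the direct one has `P = p + k p'`, `R = k b + r`, the dual one
`P = k p' + p' - p`, `R = k b + b - r`. -/
theorem higherLevel_flow (hs : 1 ≤ s ∧ s ≤ p' - 1) (hb : 1 ≤ b ∧ b ≤ p' - 1) {t : ℂ}
    (ht : t.re < 0) {P : ℤ} (hP : 0 < P) (R : ℤ) {N ℓ σ : ℕ} (hN : 1 ≤ N) (hℓ : ℓ ≤ N)
    (hσ : (σ : ℤ) ≡ R [ZMOD 2]) (hpar : Even ((ℓ : ℤ) + |b - s| + N * R)) :
    HigherLevelLHSConverges t N (b - s).natAbs ℓ σ (alphaSeq (Complex.exp t) p' b s P R) ∧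
    BranchingConverges t p' (p' + N * P) N s (b + N * R) ℓ ∧
    higherLevelLHS t N (b - s).natAbs ℓ σ (alphaSeq (Complex.exp t) p' b s P R) =
      branching t p' (p' + N * P) N s (b + N * R) ℓ := by
  have hN' : (1 : ℤ) ≤ N := by exact_mod_cast hN
  have hPP : 0 < p' * (p' + N * P) := mul_pos (by omega) (by nlinarith)
  have hpar' : (2 : ℤ) ∣ s - (b + N * R) + ℓ := by
    have := hpar.two_dvd
    generalize (N : ℤ) * R = x at this ⊢
    rcases abs_cases (b - s) with ⟨h, _⟩ | ⟨h, _⟩ <;> rw [h] at this <;> omega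
  have s1 : Summable fun j => thetaTermFirst t p' (p' + N * P) N s (b + N * R) (-j) :=
    (Equiv.neg ℤ).summable_iff.2 (summable_thetaTermFirst ht hPP hN s (b + N * R))
  have s2 := summable_thetaTermSecond ht hPP hN s (b + N * R)
  refine ⟨?_, branchingConverges ht hPP hN hℓ _ _, ?_⟩
  · have h1 : Summable fun L : ℕ =>
        qpow t ((L : ℚ) * (L + (b - s).natAbs) / N) * alphaSeq (Complex.exp t) p' b s P R L := by
      refine (hasSum_alphaSeq_mul hs hb (Complex.exp t) P R
        (F := fun L => qpow t ((L : ℚ) * (L + (b - s).natAbs) / N))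
        (s1.congr fun j => (posTerm_eq hs hb t hN P R j).symm)
        (s2.congr fun j => (negTerm_eq hs hb t hN P R j).symm)).summable.congr fun L => ?_
      rw [mul_comm]
    exact (summable_mul_of_summable_norm h1.norm
      (summable_parafermionTerm ht hN hℓ).norm).comp_injective
      (i := fun x : (L : ℕ) × etaRange N (b - s).natAbs ℓ σ L => (x.1, (x.2 : Fin (N - 1) → ℕ)))
      (by
        rintro ⟨L, η⟩ ⟨L', η'⟩ h
        obtain ⟨rfl, h2⟩ := Prod.mk.inj h
        exact congrArg _ (Subtype.ext h2))
  · have p1 : ∀ j, parafermionSum t N ℓ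
          (N * σ - (2 * (posIndex p' b s j : ℤ) + (b - s).natAbs)) =
        parafermionSum t N ℓ (s - (b + N * R) + 2 * (p' + N * P) * -j) := by
      intro j
      rw [Int.natCast_natAbs, two_mul_posIndex hs hb]
      refine parafermionSum_sub_abs ht hN hℓ hσ ?_ (Or.inr ⟨-(P * j), by ring⟩)
      rw [show s - (b + N * R) + 2 * (p' + N * P) * -j + ℓ =
        s - (b + N * R) + ℓ + 2 * ((p' + N * P) * -j) by ring]
      exact dvd_add hpar' (Dvd.intro _ rfl)
    have p2 : ∀ j, parafermionSum t N ℓ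
          (N * σ - (2 * (negIndex p' b s j : ℤ) + (b - s).natAbs)) =
        parafermionSum t N ℓ (s + (b + N * R) + 2 * (p' + N * P) * j) := by
      intro j
      rw [Int.natCast_natAbs, two_mul_negIndex hs hb]
      refine parafermionSum_sub_abs ht hN hℓ hσ ?_ (Or.inl ⟨P * j, by ring⟩)
      rw [show s + (b + N * R) + 2 * (p' + N * P) * j + ℓ =
        s - (b + N * R) + ℓ + 2 * (b + N * R + (p' + N * P) * j) by ring]
      exact dvd_add hpar' (Dvd.intro _ rfl)
    let F : ℕ → ℂ := fun L => qpow t ((L : ℚ) * (L + (b - s).natAbs) / N) *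
      parafermionSum t N ℓ (N * σ - (2 * (L : ℤ) + (b - s).natAbs))
    have f1 : ∀ j, Complex.exp t ^ posExp p' s P R j * F (posIndex p' b s j) =
        thetaTermFirst t p' (p' + N * P) N s (b + N * R) (-j) *
          parafermionSum t N ℓ (s - (b + N * R) + 2 * (p' + N * P) * -j) := fun j => by
      rw [← p1, ← posTerm_eq hs hb t hN, mul_assoc]
    have f2 : ∀ j, Complex.exp t ^ negExp p' s P R j * F (negIndex p' b s j) =
        thetaTermSecond t p' (p' + N * P) N s (b + N * R) j *
          parafermionSum t N ℓ (s + (b + N * R) + 2 * (p' + N * P) * j) := fun j => by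
      rw [← p2, ← negTerm_eq hs hb t hN, mul_assoc]
    have key := (hasSum_alphaSeq_mul hs hb (Complex.exp t) P R (F := F)
      ((summable_mul_parafermionSum ht hN hℓ s1 _).congr fun j => (f1 j).symm)
      ((summable_mul_parafermionSum ht hN hℓ s2 _).congr fun j => (f2 j).symm)).tsum_eq
    rw [branching_eq ht hPP hN hℓ hpar', higherLevelLHS]
    congr 1
    have hneg := (Equiv.neg ℤ).tsum_eq fun j =>
      thetaTermFirst t p' (p' + N * P) N s (b + N * R) j *
        parafermionSum t N ℓ (s - (b + N * R) + 2 * (p' + N * P) * j)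
    simp only [Equiv.neg_apply] at hneg
    rw [tsum_congr f1, tsum_congr f2, hneg] at key
    rw [← key]
    refine tsum_congr fun L => ?_
    rw [etaRange_eq hN, ← parafermionSum]
    simp only [F]
    ring

end

theorem mainTheorem1 (t : ℂ) (ht : t.re < 0) (p p' r s b : ℤ)
    (hr : 1 ≤ r ∧ r ≤ p - 1) (hs : 1 ≤ s ∧ s ≤ p' - 1) (hb : 1 ≤ b ∧ b ≤ p' - 1) :
    -- the source of the flows: the polynomials tend to the characters of `M(p,p') = (p,p')_1`
    (∀ ℓ : ℕ, ℓ ≤ 1 → Even (r - s + ℓ) →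
      BranchingConverges t p p' 1 r s ℓ ∧
      Filter.Tendsto (fun L : ℕ => bosonicB (Complex.exp t) p p' r s (2 * L + (b - s).natAbs) b)
        Filter.atTop (nhds (branching t p p' 1 r s ℓ))) ∧
    -- the flow `M(p,p') → (p', p' + N (k p' + p))_N`
    (∀ k : ℕ,
      IsBaileyPair (Complex.exp t) (Complex.exp t ^ (b - s).natAbs)
        (alphaBP (Complex.exp t) p p' r s b k) (betaBP (Complex.exp t) p p' r s b k) ∧
      ∀ N ℓ σ : ℕ, 1 ≤ N → ℓ < N → σ ≤ 1 → (σ : ℤ) ≡ k * b + r [ZMOD 2] →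
        Even ((ℓ : ℤ) + |b - s| + N * (k * b + r)) →
        HigherLevelLHSConverges t N (b - s).natAbs ℓ σ (alphaBP (Complex.exp t) p p' r s b k) ∧
        BranchingConverges t p' (p' + N * (p + k * p')) N s (b + N * (k * b + r)) ℓ ∧
        higherLevelLHS t N (b - s).natAbs ℓ σ (alphaBP (Complex.exp t) p p' r s b k) =
          branching t p' (p' + N * (p + k * p')) N s (b + N * (k * b + r)) ℓ) ∧
    -- the dual flow `M(p,p') →^d (p', p' + N (k p' + p' - p))_N`
    (p < p' → ∀ k : ℕ,
      IsBaileyPair (Complex.exp t) (Complex.exp t ^ (b - s).natAbs)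
        (alphaDualBP (Complex.exp t) p p' r s b k) (betaDualBP (Complex.exp t) p p' r s b k) ∧
      ∀ N ℓ σ : ℕ, 1 ≤ N → ℓ < N → σ ≤ 1 → (σ : ℤ) ≡ k * b + b - r [ZMOD 2] →
        Even ((ℓ : ℤ) + |b - s| + N * (k * b + b - r)) →
        HigherLevelLHSConverges t N (b - s).natAbs ℓ σ
          (alphaDualBP (Complex.exp t) p p' r s b k) ∧
        BranchingConverges t p' (p' + N * (k * p' + p' - p)) N s
          (b + N * (k * b + b - r)) ℓ ∧
        higherLevelLHS t N (b - s).natAbs ℓ σ (alphaDualBP (Complex.exp t) p p' r s b k) =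
          branching t p' (p' + N * (k * p' + p' - p)) N s (b + N * (k * b + b - r)) ℓ) := by
  have hq := norm_exp_lt_one ht
  have hq0 := Complex.exp_ne_zero t
  have hp : 0 < p := by omega
  have hp' : 0 < p' := by omega
  refine ⟨fun ℓ hℓ hpar => ⟨branchingConverges ht (mul_pos hp hp') le_rfl hℓ r s,
    tendsto_bosonicB ht hp hs hb hℓ hpar⟩, fun k => ⟨isBaileyPair_alphaBP hs hb hq hq0 p r k,
      fun N ℓ σ hN hℓ _ hσ hpar => ?_⟩, fun hlt k =>
      ⟨isBaileyPair_alphaDualBP hs hb hq hq0 p r k, fun N ℓ σ hN hℓ _ hσ hpar => ?_⟩⟩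
  · exact higherLevel_flow hs hb ht (by positivity) _ hN hℓ.le hσ hpar
  · have hk : 0 ≤ (k : ℤ) * p' := by positivity
    exact higherLevel_flow hs hb ht (by linarith) _ hN hℓ.le hσ hpar
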